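/- Let $r\in\{4,5,\dots\}\cup\{\infty\}$ and let $c:\mathbb R\to\mathbb R^3$ be a simple closed Frenet curve of length $L>0$, that is, a $C^\infty$, $L$-periodic curve, parametrized by arc length and injective on $[0,L)$, whose curvature $k=|c''|$ is everywhere positive. Suppose that $c$ is planar or spherical, that is, its trace lies in a plane or on a sphere. Then there exists a germ along $c$ of an oriented embedded surface of class $C^r$ in $\mathbb R^3$ that contains $c$ and has it as a hyperbolic principal cycle if and only if $c$ is not a circle. Here such a germ is represented by a $C^r$ immersion $X(s,v)$, $s\in\mathbb R$, $|v|<\varepsilon$, that is $L$-periodic in $s$, injective on $[0,L)\times(-\varepsilon,\varepsilon)$ and satisfies $X(s,0)=c(s)$, oriented by the normal $X_s\wedge X_v$. With the coefficients $E,F,G$ and $e,f,g$ of its first and second fundamental forms, a principal curvature line is a regular curve $(s(t),v(t))$ that satisfies $$(Fg-Gf)\,\dot v^2+(Eg-Ge)\,\dot s\,\dot v+(Ef-Fe)\,\dot s^2=0$$ and avoids the umbilic points (where the three coefficients vanish simultaneously). Away from the umbilic points, these lines form two foliations, along which the normal curvature is respectively minimal and maximal. The curve $c$ is a principal cycle if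 $v=0$ is a principal curvature line. It is hyperbolic if $\pi'(0)\neq1$, where the Poincaré return map $\pi$ sends $v_0$ near $0$ to $v(L)$, for the leaf $(s,v(s))$, $0\le s\le L$, with $v(0)=v_0$, of the foliation to which $c$ belongs. -/

import Mathlib

noncomputable section

namespace PrincipalCycle

/-- Euclidean space `ℝ³`. -/
abbrev E3 : Type := EuclideanSpace ℝ (Fin 3)

/-! ### Curves -/

/-- `c` is a simple closed Frenet curve of length `L`: an `L`-periodic smooth curve parametrized by
arc length, injective on one period, with everywhere positive curvature `‖c''‖`. -/
structure IsClosedFrenetCurve (L : ℝ) (c : ℝ → E3) : Prop where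
  length_pos : 0 < L
  smooth : ContDiff ℝ (⊤ : ℕ∞) c
  periodic : Function.Periodic c L
  unit_speed : ∀ s, ‖deriv c s‖ = 1
  simple : Set.InjOn c (Set.Ico 0 L)
  curvature_pos : ∀ s, 0 < ‖deriv (deriv c) s‖

/-- `S` is a (round) circle in `ℝ³`, with centre `p`, radius `R`, in the plane through `p`
orthogonal to `n`. -/
def IsCircle (S : Set E3) : Prop :=
  ∃ (p n : E3) (R : ℝ), 0 < R ∧ n ≠ 0 ∧ S = {x | dist x p = R ∧ inner ℝ n (x - p) = 0}

/-! ### Fundamental forms of a parametrized surface -/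

/-- Partial derivative in the first variable `u`. -/
def du (X : ℝ × ℝ → E3) (p : ℝ × ℝ) : E3 := fderiv ℝ X p (1, 0)

/-- Partial derivative in the second variable `v`. -/
def dv (X : ℝ × ℝ → E3) (p : ℝ × ℝ) : E3 := fderiv ℝ X p (0, 1)

/-- The determinant `det[a, b, c]` of three vectors of `ℝ³`. -/
def det3 (a b c : E3) : ℝ := Matrix.det !![a 0, a 1, a 2; b 0, b 1, b 2; c 0, c 1, c 2]

/-- `E = ⟨X_u, X_u⟩`. -/
def coeffE (X : ℝ × ℝ → E3) (p : ℝ × ℝ) : ℝ := inner ℝ (du X p) (du X p)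

/-- `F = ⟨X_u, X_v⟩`. -/
def coeffF (X : ℝ × ℝ → E3) (p : ℝ × ℝ) : ℝ := inner ℝ (du X p) (dv X p)

/-- `G = ⟨X_v, X_v⟩`. -/
def coeffG (X : ℝ × ℝ → E3) (p : ℝ × ℝ) : ℝ := inner ℝ (dv X p) (dv X p)

/-- `√(EG - F²)`, the norm of `X_u ∧ X_v`. -/
def areaDensity (X : ℝ × ℝ → E3) (p : ℝ × ℝ) : ℝ :=
  Real.sqrt (coeffE X p * coeffG X p - coeffF X p ^ 2)

/-- `e = det[X_u, X_v, X_uu] / √(EG - F²)`, that is `⟨X_uu, N⟩` for the positive unit normal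
`N = (X_u ∧ X_v) / |X_u ∧ X_v|`. -/
def coeffe (X : ℝ × ℝ → E3) (p : ℝ × ℝ) : ℝ :=
  det3 (du X p) (dv X p) (du (du X) p) / areaDensity X p

/-- `f = det[X_u, X_v, X_uv] / √(EG - F²)`. -/
def coefff (X : ℝ × ℝ → E3) (p : ℝ × ℝ) : ℝ :=
  det3 (du X p) (dv X p) (dv (du X) p) / areaDensity X p

/-- `g = det[X_u, X_v, X_vv] / √(EG - F²)`. -/
def coeffg (X : ℝ × ℝ → E3) (p : ℝ × ℝ) : ℝ :=
  det3 (du X p) (dv X p) (dv (dv X) p) / areaDensity X p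

/-- The first fundamental form `E du² + 2F du dv + G dv²` on the tangent vector `w = (du, dv)`. -/
def firstForm (X : ℝ × ℝ → E3) (p w : ℝ × ℝ) : ℝ :=
  coeffE X p * w.1 ^ 2 + 2 * coeffF X p * w.1 * w.2 + coeffG X p * w.2 ^ 2

/-- The second fundamental form `e du² + 2f du dv + g dv²` on the tangent vector `w = (du, dv)`. -/
def secondForm (X : ℝ × ℝ → E3) (p w : ℝ × ℝ) : ℝ :=
  coeffe X p * w.1 ^ 2 + 2 * coefff X p * w.1 * w.2 + coeffg X p * w.2 ^ 2

/-! ### Principal curvature lines -/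

/-- Coefficient `Fg - Gf` of `dv²` in the equation of principal curvature lines. -/
def princL (X : ℝ × ℝ → E3) (p : ℝ × ℝ) : ℝ := coeffF X p * coeffg X p - coeffG X p * coefff X p

/-- Coefficient `Eg - Ge` of `du dv` in the equation of principal curvature lines. -/
def princM (X : ℝ × ℝ → E3) (p : ℝ × ℝ) : ℝ := coeffE X p * coeffg X p - coeffG X p * coeffe X p

/-- Coefficient `Ef - Fe` of `du²` in the equation of principal curvature lines. -/
def princN (X : ℝ × ℝ → E3) (p : ℝ × ℝ) : ℝ := coeffE X p * coefff X p - coeffF X p * coeffe X p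

/-- `p` is an umbilic point: the three coefficients vanish simultaneously. -/
def IsUmbilic (X : ℝ × ℝ → E3) (p : ℝ × ℝ) : Prop :=
  princL X p = 0 ∧ princM X p = 0 ∧ princN X p = 0

/-- The nonzero tangent vector `w` satisfies the equation of principal directions at `p`. -/
def IsPrincipalDirection (X : ℝ × ℝ → E3) (p w : ℝ × ℝ) : Prop :=
  w ≠ 0 ∧ princL X p * w.2 ^ 2 + princM X p * w.1 * w.2 + princN X p * w.1 ^ 2 = 0

/-- The two principal foliations: along the first (resp. second) one the normal curvature attains
its minimum (resp. maximum). -/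
inductive Foliation : Type
  | minimal
  | maximal

/-- The normal curvature `secondForm / firstForm` attains at `w` its minimum (resp. maximum) over
all tangent directions at `p` (the inequality between the two quotients is cleared of its
denominators, which are positive at a regular point). -/
def AttainsExtremum (X : ℝ × ℝ → E3) : Foliation → ℝ × ℝ → ℝ × ℝ → Prop
  | .minimal, p, w => ∀ w', secondForm X p w * firstForm X p w' ≤ secondForm X p w' * firstForm X p w
  | .maximal, p, w => ∀ w', secondForm X p w' * firstForm X p w ≤ secondForm X p w * firstForm X p w'

/-- The curve `γ` in the parameter domain, defined on the interval `J`, is a principal curvature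
line: a regular integral curve of the equation of principal directions that avoids the umbilics. -/
def IsPrincipalLine (X : ℝ × ℝ → E3) (J : Set ℝ) (γ : ℝ → ℝ × ℝ) : Prop :=
  ∀ t ∈ J, ¬ IsUmbilic X (γ t) ∧
    ∃ w, HasDerivWithinAt γ w J t ∧ IsPrincipalDirection X (γ t) w

/-- The curve `γ` is a principal curvature line that belongs to the foliation `i`. -/
def IsLeaf (X : ℝ × ℝ → E3) (i : Foliation) (J : Set ℝ) (γ : ℝ → ℝ × ℝ) : Prop :=
  IsPrincipalLine X J γ ∧ ∀ t ∈ J, ∀ w, HasDerivWithinAt γ w J t → AttainsExtremum X i (γ t) w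

/-! ### Germs of surfaces along a closed curve, and hyperbolic principal cycles -/

/-- `X`, on the strip `|v| < ε`, represents a germ along `c` of an oriented embedded surface of
class `C^r` containing `c`. As `c` is a simple closed curve and the surface is oriented, the
surface is an annulus near `c`; it is parametrized by an immersion of class `C^r`, `L`-periodic in
the first variable and injective modulo the period, whose core `v = 0` is `c`. The orientation is
that of the unit normal `(X_u ∧ X_v) / |X_u ∧ X_v|`. -/
structure IsOrientedSurfaceGerm (r : ℕ∞) (L : ℝ) (c : ℝ → E3) (ε : ℝ) (X : ℝ × ℝ → E3) :
    Prop where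
  width_pos : 0 < ε
  contDiffOn : ContDiffOn ℝ r X (Set.univ ×ˢ Set.Ioo (-ε) ε)
  periodic : ∀ s, ∀ v ∈ Set.Ioo (-ε) ε, X (s + L, v) = X (s, v)
  immersion : ∀ p ∈ (Set.univ : Set ℝ) ×ˢ Set.Ioo (-ε) ε, Function.Injective (fderiv ℝ X p)
  embedded : Set.InjOn X (Set.Ico 0 L ×ˢ Set.Ioo (-ε) ε)
  core : ∀ s, X (s, 0) = c s

/-- `π` is (on a neighbourhood of `0`) the Poincaré return map of the foliation `i` along the core
`v = 0`, from the transversal `{s = 0}` to `{s = L}`, which is the same transversal on the annulus: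
for `v₀` close to `0` the leaf `s ↦ (s, v s)` starting at `(0, v₀)` goes once around the annulus
and ends at `(L, π v₀)`. -/
def IsReturnMap (X : ℝ × ℝ → E3) (L ε : ℝ) (i : Foliation) (π : ℝ → ℝ) : Prop :=
  ∀ᶠ v₀ in nhds (0 : ℝ), ∃ v : ℝ → ℝ,
    (∀ s ∈ Set.Icc 0 L, v s ∈ Set.Ioo (-ε) ε) ∧
    IsLeaf X i (Set.Icc 0 L) (fun s => (s, v s)) ∧ v 0 = v₀ ∧ v L = π v₀

/-- The core `v = 0` of the annulus is a hyperbolic principal cycle: it is a principal curvature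
line, belonging to one of the two principal foliations, and the first derivative at `0` of the
Poincaré return map of that foliation is different from one. -/
def IsHyperbolicPrincipalCycle (X : ℝ × ℝ → E3) (L ε : ℝ) : Prop :=
  ∃ i : Foliation, IsLeaf X i Set.univ (fun s => (s, 0)) ∧
    ∃ (π : ℝ → ℝ) (d : ℝ), IsReturnMap X L ε i π ∧ HasDerivAt π d 0 ∧ d ≠ 1

end PrincipalCycle

end

/-!
Let `c` be planar or spherical. The plane or sphere provides a unit normal field `q` along `c` with
`q' = l c'` for a constant `l` (`IsParallelNormal`), so that `ν = c' × q` is a unit normal field with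
`ν' = -κ c'`, where `κ = det[c', q, c'']` (`parallelCurvature`).

*The multiplier of a principal cycle.* Write the equation of principal lines as
`L v'² + M v' + N = 0` with `N = 0`, `M ≠ 0` on the core. The foliation containing the core is
selected by comparing normal curvatures with those of the direction `(1, 0)`, which bounds the
slope by `2 |N / M|`; hence its leaves satisfy `v' = a v + o(v)` with `a = -N_v / M`, uniformly
along the core, and the return map has derivative `exp (∫ a)` whichever leaves define it
(`hasDerivAt_return_map`). No uniqueness theorem for leaves is needed. The computation of `N_v`
(`principal_jet_identity`, `transversal_derivative`) shows that `a` is the derivative of a periodic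
function minus `k' / (k₂ - k)`, where `k` is the normal curvature of the core and `k₂` the other
principal curvature. All of this is done with the coefficients of the second form multiplied by
`√(EG - F²)`, which are polynomials in the derivatives of the surface.

*Circles.* On a circle, the normal curvature of a principal line is constant, so that `a` is the
derivative of a periodic function and the multiplier is `1`
(`IsClosedFrenetCurve.not_hyperbolic_of_isCircle`).

*Other curves.* If `κ` is constant then `c''' = -ω² c'` and `c` is a circle
(`IsParallelNormal.third_deriv`, `IsClosedFrenetCurve.isCircle_of_third_deriv`). Otherwise the
surface `c + v q + (m v² / 2) ν` has principal curvatures `κ` and `m` along `c`, and the choice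
`m = κ + exp (-κ')` gives the multiplier `exp (-∫ κ' exp κ') < 1`, because `x exp x ≥ x` with
equality only at `0` (`IsParallelNormal.exists_hyperbolic`). The leaves that define the return map
come from the Picard-Lindelöf theorem (`exists_leaf`), and a compactness argument makes the surface
embedded near `c` (`IsClosedFrenetCurve.exists_embedded`).
-/

noncomputable section

namespace PrincipalCycle

open Set Filter Topology
open scoped InnerProductSpace

/-! ### Determinants and cross products in `ℝ³` -/

lemma inner_eq (a b : E3) : ⟪a, b⟫_ℝ = a 0 * b 0 + a 1 * b 1 + a 2 * b 2 := by
  simp [PiLp.inner_apply, Fin.sum_univ_three, mul_comm]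

lemma det3_eq (a b c : E3) : det3 a b c = a 0 * b 1 * c 2 - a 0 * b 2 * c 1 - a 1 * b 0 * c 2 +
    a 1 * b 2 * c 0 + a 2 * b 0 * c 1 - a 2 * b 1 * c 0 := by
  simp [det3, Matrix.det_fin_three]

/-- The cross product on Euclidean space `ℝ³`. -/
def cross (a b : E3) : E3 :=
  !₂[a 1 * b 2 - a 2 * b 1, a 2 * b 0 - a 0 * b 2, a 0 * b 1 - a 1 * b 0]

@[simp] lemma cross_zero' (a b : E3) : cross a b 0 = a 1 * b 2 - a 2 * b 1 := rfl
@[simp] lemma cross_one' (a b : E3) : cross a b 1 = a 2 * b 0 - a 0 * b 2 := rfl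
@[simp] lemma cross_two' (a b : E3) : cross a b 2 = a 0 * b 1 - a 1 * b 0 := rfl

lemma inner_cross (a b c : E3) : ⟪cross a b, c⟫_ℝ = det3 a b c := by
  rw [inner_eq, det3_eq]; simp; ring

lemma E3.ext_coord {a b : E3} (h0 : a 0 = b 0) (h1 : a 1 = b 1) (h2 : a 2 = b 2) : a = b := by
  ext i; fin_cases i <;> assumption

/-- The square of a determinant is the Gram determinant. -/
lemma det3_sq (a b c : E3) : det3 a b c ^ 2 =
    ⟪a, a⟫_ℝ * (⟪b, b⟫_ℝ * ⟪c, c⟫_ℝ - ⟪b, c⟫_ℝ ^ 2)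
      - ⟪a, b⟫_ℝ * (⟪a, b⟫_ℝ * ⟪c, c⟫_ℝ - ⟪b, c⟫_ℝ * ⟪a, c⟫_ℝ)
      + ⟪a, c⟫_ℝ * (⟪a, b⟫_ℝ * ⟪b, c⟫_ℝ - ⟪b, b⟫_ℝ * ⟪a, c⟫_ℝ) := by
  simp only [inner_eq, det3_eq]; ring

lemma det3_cross_self (a b : E3) :
    det3 a b (cross a b) = ⟪a, a⟫_ℝ * ⟪b, b⟫_ℝ - ⟪a, b⟫_ℝ ^ 2 := by
  simp only [inner_eq, det3_eq, cross_zero', cross_one', cross_two']; ring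

lemma inner_cross_cross (a b : E3) :
    ⟪cross a b, cross a b⟫_ℝ = ⟪a, a⟫_ℝ * ⟪b, b⟫_ℝ - ⟪a, b⟫_ℝ ^ 2 := by
  rw [inner_cross, det3_cross_self]

lemma inner_left_cross (a b : E3) : ⟪a, cross a b⟫_ℝ = 0 := by
  simp only [inner_eq, cross_zero', cross_one', cross_two']; ring

lemma inner_right_cross (a b : E3) : ⟪b, cross a b⟫_ℝ = 0 := by
  simp only [inner_eq, cross_zero', cross_one', cross_two']; ring

/-- A vector orthogonal to three independent vectors vanishes. -/
lemma eq_zero_of_inner_eq_zero {a b c x : E3} (h : det3 a b c ≠ 0) (ha : ⟪a, x⟫_ℝ = 0)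
    (hb : ⟪b, x⟫_ℝ = 0) (hc : ⟪c, x⟫_ℝ = 0) : x = 0 := by
  rw [inner_eq] at ha hb hc
  rw [det3_eq] at h
  refine E3.ext_coord ?_ ?_ ?_ <;> refine mul_left_cancel₀ h ?_
  · simp only [PiLp.zero_apply]
    linear_combination (b 1 * c 2 - b 2 * c 1) * ha + (a 2 * c 1 - a 1 * c 2) * hb
      + (a 1 * b 2 - a 2 * b 1) * hc
  · simp only [PiLp.zero_apply]
    linear_combination (b 2 * c 0 - b 0 * c 2) * ha + (a 0 * c 2 - a 2 * c 0) * hb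
      + (a 2 * b 0 - a 0 * b 2) * hc
  · simp only [PiLp.zero_apply]
    linear_combination (b 0 * c 1 - b 1 * c 0) * ha + (a 1 * c 0 - a 0 * c 1) * hb
      + (a 0 * b 1 - a 1 * b 0) * hc

/-- Expansion of a vector in the positive orthonormal frame `(a, b, a × b)`. -/
lemma frame_expansion {a b : E3} (ha : ⟪a, a⟫_ℝ = 1) (hb : ⟪b, b⟫_ℝ = 1) (hab : ⟪a, b⟫_ℝ = 0)
    (x : E3) : x = ⟪a, x⟫_ℝ • a + ⟪b, x⟫_ℝ • b + det3 a b x • cross a b := by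
  have hd : det3 a b (cross a b) = 1 := by rw [det3_cross_self, ha, hb, hab]; norm_num
  have hba : ⟪b, a⟫_ℝ = 0 := by rw [real_inner_comm, hab]
  have hca : ⟪cross a b, a⟫_ℝ = 0 := by rw [real_inner_comm, inner_left_cross]
  have hcb : ⟪cross a b, b⟫_ℝ = 0 := by rw [real_inner_comm, inner_right_cross]
  rw [← sub_eq_zero]
  refine eq_zero_of_inner_eq_zero (a := a) (b := b) (c := cross a b) (by rw [hd]; norm_num)
    ?_ ?_ ?_ <;>
  simp only [inner_sub_right, inner_add_right, inner_smul_right, ha, hab, hb, hba, hca, hcb,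
    inner_left_cross, inner_right_cross, inner_cross_cross] <;>
  simp [inner_cross]

lemma inner_frame {a b : E3} (ha : ⟪a, a⟫_ℝ = 1) (hb : ⟪b, b⟫_ℝ = 1) (hab : ⟪a, b⟫_ℝ = 0)
    (x₁ x₂ x₃ y₁ y₂ y₃ : ℝ) :
    ⟪x₁ • a + x₂ • b + x₃ • cross a b, y₁ • a + y₂ • b + y₃ • cross a b⟫_ℝ =
      x₁ * y₁ + x₂ * y₂ + x₃ * y₃ := by
  have hba : ⟪b, a⟫_ℝ = 0 := by rw [real_inner_comm, hab]
  have h1 : ⟪cross a b, a⟫_ℝ = 0 := by rw [real_inner_comm, inner_left_cross]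
  have h2 : ⟪cross a b, b⟫_ℝ = 0 := by rw [real_inner_comm, inner_right_cross]
  simp only [inner_add_left, inner_add_right, inner_smul_left, inner_smul_right, ha, hb, hab, hba,
    inner_cross_cross, h1, h2, inner_left_cross, inner_right_cross]
  simp; ring

lemma det3_frame {a b : E3} (ha : ⟪a, a⟫_ℝ = 1) (hb : ⟪b, b⟫_ℝ = 1) (hab : ⟪a, b⟫_ℝ = 0)
    (x₁ x₂ x₃ y₁ y₂ y₃ z₁ z₂ z₃ : ℝ) :
    det3 (x₁ • a + x₂ • b + x₃ • cross a b) (y₁ • a + y₂ • b + y₃ • cross a b)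
      (z₁ • a + z₂ • b + z₃ • cross a b) =
      x₁ * y₂ * z₃ - x₁ * y₃ * z₂ - x₂ * y₁ * z₃ + x₂ * y₃ * z₁ + x₃ * y₁ * z₂ - x₃ * y₂ * z₁ := by
  have hd : det3 a b (cross a b) = 1 := by rw [det3_cross_self, ha, hb, hab]; norm_num
  generalize cross a b = n at *
  rw [det3_eq] at hd ⊢
  simp only [PiLp.add_apply, PiLp.smul_apply, smul_eq_mul]
  linear_combination (x₁ * y₂ * z₃ - x₁ * y₃ * z₂ - x₂ * y₁ * z₃ + x₂ * y₃ * z₁ + x₃ * y₁ * z₂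
    - x₃ * y₂ * z₁) * hd

lemma hasDerivAt_coord {f : ℝ → E3} {f' : E3} {t : ℝ} :
    HasDerivAt f f' t ↔ ∀ i, HasDerivAt (fun t => f t i) (f' i) t := by
  rw [hasDerivAt_iff_hasFDerivAt, ← hasFDerivWithinAt_univ, hasFDerivWithinAt_euclidean]
  refine forall_congr' fun i => ?_
  rw [hasDerivAt_iff_hasFDerivAt, ← hasFDerivWithinAt_univ]
  have : (EuclideanSpace.proj i : E3 →L[ℝ] ℝ).comp (ContinuousLinearMap.toSpanSingleton ℝ f') =
      ContinuousLinearMap.toSpanSingleton ℝ (f' i) := by ext; simp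
  rw [← this]

lemma _root_.HasDerivAt.det3 {f g h : ℝ → E3} {f' g' h' : E3} {t : ℝ} (hf : HasDerivAt f f' t)
    (hg : HasDerivAt g g' t) (hh : HasDerivAt h h' t) :
    HasDerivAt (fun t => det3 (f t) (g t) (h t))
      (det3 f' (g t) (h t) + det3 (f t) g' (h t) + det3 (f t) (g t) h') t := by
  simp only [det3_eq]
  have hf := hasDerivAt_coord.1 hf
  have hg := hasDerivAt_coord.1 hg
  have hh := hasDerivAt_coord.1 hh
  exact ((((((((hf 0).mul (hg 1)).mul (hh 2)).sub (((hf 0).mul (hg 2)).mul (hh 1))).sub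
    (((hf 1).mul (hg 0)).mul (hh 2))).add (((hf 1).mul (hg 2)).mul (hh 0))).add
    (((hf 2).mul (hg 0)).mul (hh 1))).sub (((hf 2).mul (hg 1)).mul (hh 0))).congr_deriv (by
    simp only [Pi.mul_apply]; ring)

lemma _root_.HasDerivAt.cross {f g : ℝ → E3} {f' g' : E3} {t : ℝ} (hf : HasDerivAt f f' t)
    (hg : HasDerivAt g g' t) :
    HasDerivAt (fun t => cross (f t) (g t)) (cross f' (g t) + cross (f t) g') t := by
  have hf := hasDerivAt_coord.1 hf
  have hg := hasDerivAt_coord.1 hg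
  refine hasDerivAt_coord.2 fun i => ?_
  fin_cases i
  · exact (((hf 1).mul (hg 2)).sub ((hf 2).mul (hg 1))).congr_deriv
      (by simp; ring)
  · exact (((hf 2).mul (hg 0)).sub ((hf 0).mul (hg 2))).congr_deriv
      (by simp; ring)
  · exact (((hf 0).mul (hg 1)).sub ((hf 1).mul (hg 0))).congr_deriv
      (by simp; ring)

section Smoothness

variable {V : Type*} [NormedAddCommGroup V] [NormedSpace ℝ V] {n : WithTop ℕ∞}

lemma _root_.ContDiffAt.det3 {f g h : V → E3} {x : V} (hf : ContDiffAt ℝ n f x) (hg : ContDiffAt ℝ n g x)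
    (hh : ContDiffAt ℝ n h x) : ContDiffAt ℝ n (fun x => det3 (f x) (g x) (h x)) x := by
  simp only [det3_eq]
  have hf := contDiffAt_euclidean.1 hf
  have hg := contDiffAt_euclidean.1 hg
  have hh := contDiffAt_euclidean.1 hh
  exact (((((((hf 0).mul (hg 1)).mul (hh 2)).sub (((hf 0).mul (hg 2)).mul (hh 1))).sub
    (((hf 1).mul (hg 0)).mul (hh 2))).add (((hf 1).mul (hg 2)).mul (hh 0))).add
    (((hf 2).mul (hg 0)).mul (hh 1))).sub (((hf 2).mul (hg 1)).mul (hh 0))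

lemma _root_.ContDiff.cross {f g : V → E3} (hf : ContDiff ℝ n f) (hg : ContDiff ℝ n g) :
    ContDiff ℝ n (fun x => cross (f x) (g x)) := by
  have hf := contDiff_euclidean.1 hf
  have hg := contDiff_euclidean.1 hg
  refine contDiff_euclidean.2 fun i => ?_
  fin_cases i
  · exact ((hf 1).mul (hg 2)).sub ((hf 2).mul (hg 1))
  · exact ((hf 2).mul (hg 0)).sub ((hf 0).mul (hg 2))
  · exact ((hf 0).mul (hg 1)).sub ((hf 1).mul (hg 0))

end Smoothness

/-- The first order jet of the equation of principal lines along a principal line of unit speed.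
Here `T, Y` stand for `X_u, X_v`, the suffix `₁` for one derivative and `₂` for two derivatives
in `u`, and `Z` for `X_vv`; the conclusion expresses the `v`-derivative of `Ef - Fe` (with the
coefficients of the second form multiplied by `√(EG - F²)`) through `u`-derivatives of
`Eg - Ge`, `EG - F²` and `e`. The second part expresses that the normal curvature
`e / √(EG - F²)` is constant to first order when `T₂` is tangent to the surface. -/
lemma principal_jet_identity {T Y Z T₁ Y₁ Z₁ T₂ Y₂ : E3} (hT : ⟪T, T⟫_ℝ = 1) (hT₁ : ⟪T, T₁⟫_ℝ = 0)
    (hQ : 0 < ⟪Y, Y⟫_ℝ - ⟪T, Y⟫_ℝ ^ 2)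
    (hp : det3 T Y Y₁ = ⟪T, Y⟫_ℝ * det3 T Y T₁)
    (hp₁ : det3 T₁ Y Y₁ + det3 T Y Y₂ = (⟪T₁, Y⟫_ℝ + ⟪T, Y₁⟫_ℝ) * det3 T Y T₁
      + ⟪T, Y⟫_ℝ * (det3 T Y₁ T₁ + det3 T Y T₂)) :
    (⟪Y, Y⟫_ℝ - ⟪T, Y⟫_ℝ ^ 2) * (2 * ⟪T, Y₁⟫_ℝ * det3 T Y Y₁
        + (det3 T Z Y₁ + det3 T Y Z₁)
        - (⟪Y₁, Y⟫_ℝ + ⟪T, Z⟫_ℝ) * det3 T Y T₁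
        - ⟪T, Y⟫_ℝ * (det3 Y₁ Y T₁ + det3 T Z T₁ + det3 T Y Y₂)) =
      (⟪Y, Y⟫_ℝ - ⟪T, Y⟫_ℝ ^ 2) * ((det3 T₁ Y Z + det3 T Y₁ Z + det3 T Y Z₁)
        - 2 * ⟪Y, Y₁⟫_ℝ * det3 T Y T₁ - ⟪Y, Y⟫_ℝ * (det3 T Y₁ T₁ + det3 T Y T₂))
      - (det3 T Y Z - ⟪Y, Y⟫_ℝ * det3 T Y T₁)
        * (2 * ⟪Y, Y₁⟫_ℝ - 2 * ⟪T, Y⟫_ℝ * (⟪T₁, Y⟫_ℝ + ⟪T, Y₁⟫_ℝ))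
      + (⟪Y, Y⟫_ℝ - ⟪T, Y⟫_ℝ ^ 2) ^ 2 * (det3 T Y₁ T₁ + det3 T Y T₂)
      - (⟪Y, Y⟫_ℝ - ⟪T, Y⟫_ℝ ^ 2) * (⟪Y, Y₁⟫_ℝ - ⟪T, Y⟫_ℝ * (⟪T₁, Y⟫_ℝ + ⟪T, Y₁⟫_ℝ))
        * det3 T Y T₁ ∧
    (det3 T Y T₂ = 0 → 2 * (⟪Y, Y⟫_ℝ - ⟪T, Y⟫_ℝ ^ 2) * (det3 T Y₁ T₁ + det3 T Y T₂) =
      (2 * ⟪Y, Y₁⟫_ℝ - 2 * ⟪T, Y⟫_ℝ * (⟪T₁, Y⟫_ℝ + ⟪T, Y₁⟫_ℝ)) * det3 T Y T₁) := by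
  set F := ⟪T, Y⟫_ℝ with hF
  obtain ⟨W, hW, hWQ⟩ : ∃ W : ℝ, 0 < W ∧ W ^ 2 = ⟪Y, Y⟫_ℝ - F ^ 2 :=
    ⟨_, Real.sqrt_pos.2 hQ, Real.sq_sqrt hQ.le⟩
  -- All vectors are expanded in the orthonormal frame `(T, b, T × b)` with `Y = F T + W b`.
  set b : E3 := W⁻¹ • (Y - F • T) with hb
  have hYb : Y = F • T + W • b := by rw [hb, smul_smul, mul_inv_cancel₀ hW.ne']; simp
  have hTb : ⟪T, b⟫_ℝ = 0 := by
    rw [hb, inner_smul_right, inner_sub_right, inner_smul_right, hT, ← hF]; simp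
  have hbb : ⟪b, b⟫_ℝ = 1 := by
    have hYT : ⟪Y, T⟫_ℝ = F := by rw [hF, real_inner_comm]
    have : ⟪Y - F • T, Y - F • T⟫_ℝ = W ^ 2 := by
      simp only [inner_sub_right, inner_sub_left, inner_smul_right, inner_smul_left, hT, hYT, ← hF,
        hWQ]
      simp; ring
    rw [hb, inner_smul_right, inner_smul_left, this]
    simp; field_simp
  have ex : ∀ x : E3, ∃ x₁ x₂ x₃ : ℝ, x = x₁ • T + x₂ • b + x₃ • cross T b ∧ ⟪T, x⟫_ℝ = x₁ :=
    fun x => ⟨_, _, _, frame_expansion hT hbb hTb x, rfl⟩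
  have hI := inner_frame hT hbb hTb
  have hD := det3_frame hT hbb hTb
  have eT : T = (1 : ℝ) • T + (0 : ℝ) • b + (0 : ℝ) • cross T b := by simp
  have eY : Y = F • T + W • b + (0 : ℝ) • cross T b := by rw [zero_smul, add_zero]; exact hYb
  obtain ⟨z₁, z₂, z₃, eZ, -⟩ := ex Z
  obtain ⟨t₁, t₂, t₃, eT₁, h0⟩ := ex T₁
  obtain ⟨y₁, y₂, y₃, eY₁, -⟩ := ex Y₁
  obtain ⟨u₁, u₂, u₃, eZ₁, -⟩ := ex Z₁
  obtain ⟨r₁, r₂, r₃, eT₂, -⟩ := ex T₂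
  obtain ⟨p₁, p₂, p₃, eY₂, -⟩ := ex Y₂
  rw [hT₁] at h0
  subst h0
  clear hQ hWQ hF hT₁ ex
  clear_value F b
  generalize cross T b = ν at *
  rw [eT, eY, eT₁, eY₁, eZ, eZ₁, eT₂, eY₂]
  rw [eT, eY, eT₁, eY₁, eT₂, eY₂] at hp₁
  rw [eT, eY, eT₁, eY₁] at hp
  simp only [hI, hD] at *
  have hy₃ : y₃ = F * t₃ := mul_left_cancel₀ hW.ne' (by linear_combination hp)
  subst hy₃
  refine ⟨by linear_combination (-F * W ^ 2) * hp₁, fun h => ?_⟩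
  linear_combination (2 * W ^ 2) * h

/-! ### Return maps of implicit differential equations near a closed orbit -/

/-- A property that holds near every point of the segment `[0, L] × {0}` holds on a strip. -/
lemma exists_strip {L : ℝ} {P : ℝ × ℝ → Prop} (h : ∀ s ∈ Icc 0 L, ∀ᶠ p in 𝓝 (s, (0 : ℝ)), P p) :
    ∃ δ > 0, ∀ s ∈ Icc 0 L, ∀ v, |v| ≤ δ → P (s, v) := by
  have h1 : ∀ᶠ v in 𝓝 (0 : ℝ), ∀ s ∈ Icc 0 L, P (s, v) := by
    refine isCompact_Icc.eventually_forall_of_forall_eventually (P := fun v s => P (s, v)) ?_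
    intro s hs
    have : Tendsto (fun z : ℝ × ℝ => (z.2, z.1)) (𝓝 (0, s)) (𝓝 (s, 0)) :=
      continuous_swap.tendsto _
    exact this.eventually (h s hs)
  obtain ⟨δ, hδ, h2⟩ := Metric.eventually_nhds_iff_ball.1 h1
  refine ⟨δ / 2, by positivity, fun s hs v hv => h2 v ?_ s hs⟩
  rw [Metric.mem_ball, dist_zero_right, Real.norm_eq_abs]
  linarith

/-- The slope `σ` of the leaf through `p` of one of the two foliations `l σ² + m σ + n = 0`:
the inequality selects the root that vanishes with `n` when `m > 0`. -/
structure IsSlope (l m n : ℝ × ℝ → ℝ) (p : ℝ × ℝ) (σ : ℝ) : Prop where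
  root : l p * σ ^ 2 + m p * σ + n p = 0
  small : 2 * n p * σ + m p * σ ^ 2 ≤ 0

/-- Uniform linearization of the slope: `σ = a(s) v + o(v)`. -/
lemma eventually_slope_estimate {l m n : ℝ × ℝ → ℝ} {a : ℝ → ℝ} {s₀ : ℝ}
    (hl : ContinuousAt l (s₀, 0)) (hm : ContinuousAt m (s₀, 0)) (hn : ContDiffAt ℝ 1 n (s₀, 0))
    (hm₀ : 0 < m (s₀, 0)) (hn₀ : ∀ s, n (s, 0) = 0) (ha : ContinuousAt a s₀)
    (han : a s₀ * m (s₀, 0) = -fderiv ℝ n (s₀, 0) (0, 1)) {η : ℝ} (hη : 0 < η) :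
    ∀ᶠ p in 𝓝 (s₀, (0 : ℝ)), ∀ σ, IsSlope l m n p σ → |σ - a p.1 * p.2| ≤ η * |p.2| := by
  set m₀ := m (s₀, 0)
  set k := |a s₀| with hk
  set l₀ := |l (s₀, 0)| + 1 with hl₀
  have hk0 : 0 ≤ k := abs_nonneg _
  have hl0 : 0 < l₀ := by positivity
  obtain ⟨e, he, he1, he2, he3⟩ : ∃ e : ℝ, 0 < e ∧ e ≤ 1 ∧ e ≤ m₀ / 2 ∧
      e * (2 + k) ≤ η * m₀ / 4 := by
    refine ⟨min (min 1 (m₀ / 2)) (η * m₀ / 4 / (2 + k)), by positivity, ?_, ?_, ?_⟩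
    · exact (min_le_left _ _).trans (min_le_left _ _)
    · exact (min_le_left _ _).trans (min_le_right _ _)
    · rw [← le_div_iff₀ (by positivity)]; exact min_le_right _ _
  set C := 4 * (k * m₀ + 1) / m₀ with hC
  have hC0 : 0 < C := by positivity
  have h1 : ∀ᶠ p in 𝓝 (s₀, (0 : ℝ)), |n p + a s₀ * m₀ * p.2| ≤ e * |p.2| := by
    have hs := (hn.hasStrictFDerivAt one_ne_zero).isLittleO
    have ht : Tendsto (fun p : ℝ × ℝ => (p, (p.1, (0 : ℝ)))) (𝓝 (s₀, 0))
        (𝓝 ((s₀, 0), (s₀, 0))) := by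
      have : Continuous (fun p : ℝ × ℝ => (p, (p.1, (0 : ℝ)))) := by fun_prop
      exact this.tendsto' _ _ rfl
    filter_upwards [ht.eventually (hs.def he)] with p hp
    have e1 : p - (p.1, (0 : ℝ)) = p.2 • ((0 : ℝ), (1 : ℝ)) := by ext <;> simp
    rw [e1, map_smul, norm_smul] at hp
    simp only [hn₀, smul_eq_mul, Real.norm_eq_abs, Prod.norm_def, norm_zero, norm_one] at hp
    have e2 : n p - 0 - p.2 * fderiv ℝ n (s₀, 0) (0, 1) = n p + a s₀ * m₀ * p.2 := by
      rw [han]; ring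
    rw [e2] at hp
    simpa using hp
  have h2 : ∀ᶠ p in 𝓝 (s₀, (0 : ℝ)), |m p - m₀| ≤ e := by
    filter_upwards [hm (Metric.closedBall_mem_nhds _ he)] with p hp
    simpa [Real.dist_eq] using hp
  have h3 : ∀ᶠ p in 𝓝 (s₀, (0 : ℝ)), |l p| ≤ l₀ := by
    have : Tendsto (fun p => |l p|) (𝓝 (s₀, 0)) (𝓝 |l (s₀, 0)|) := hl.abs
    exact (this.eventually (gt_mem_nhds (lt_add_one _))).mono fun p hp => le_of_lt hp
  have h4 : ∀ᶠ p in 𝓝 (s₀, (0 : ℝ)), |a p.1 - a s₀| ≤ η / 2 := by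
    have : Tendsto (fun p : ℝ × ℝ => a p.1) (𝓝 (s₀, 0)) (𝓝 (a s₀)) :=
      ha.tendsto.comp (continuous_fst.tendsto _)
    filter_upwards [this (Metric.closedBall_mem_nhds _ (half_pos hη))] with p hp
    simpa [Real.dist_eq] using hp
  have h5 : ∀ᶠ p in 𝓝 (s₀, (0 : ℝ)), l₀ * C ^ 2 * |p.2| ≤ e := by
    have : Tendsto (fun p : ℝ × ℝ => l₀ * C ^ 2 * |p.2|) (𝓝 (s₀, 0)) (𝓝 0) := by
      have : Continuous (fun p : ℝ × ℝ => l₀ * C ^ 2 * |p.2|) := by fun_prop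
      exact this.tendsto' _ _ (by simp)
    exact (this.eventually (gt_mem_nhds he)).mono fun p hp => le_of_lt hp
  filter_upwards [h1, h2, h3, h4, h5] with p h1 h2 h3 h4 h5 σ hσ
  obtain ⟨hroot, hsmall⟩ := hσ
  set v := p.2
  have hv := abs_nonneg v
  have hmp : m₀ / 2 ≤ m p := by have := (abs_le.1 h2).1; linarith
  have hnp : |n p| ≤ (k * m₀ + 1) * |v| := by
    have : n p = (n p + a s₀ * m₀ * v) - a s₀ * m₀ * v := by ring
    rw [this]
    refine (abs_sub _ _).trans ?_
    rw [abs_mul, abs_mul, abs_of_pos hm₀, ← hk]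
    nlinarith
  -- The selection of the root bounds the slope by `2 |n| / m`, so that `l σ²` is negligible.
  have hσv : |σ| ≤ C * |v| := by
    rcases eq_or_ne σ 0 with h | h
    · rw [h, abs_zero]; positivity
    have hσ0 : 0 < |σ| := abs_pos.2 h
    have : m p * |σ| ≤ 2 * |n p| := by
      refine le_of_mul_le_mul_right ?_ hσ0
      have h6 : -(n p * σ) ≤ |n p| * |σ| := by rw [← abs_mul]; exact neg_le_abs _
      have h7 : |σ| * |σ| = σ ^ 2 := by rw [← sq, sq_abs]
      calc m p * |σ| * |σ| = m p * σ ^ 2 := by rw [mul_assoc, h7]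
        _ ≤ 2 * |n p| * |σ| := by linarith
    rw [hC, div_mul_eq_mul_div, le_div_iff₀ hm₀]
    nlinarith
  have hlσ : |l p * σ ^ 2| ≤ e * |v| := by
    rw [abs_mul, abs_pow]
    calc |l p| * |σ| ^ 2 ≤ l₀ * (C * |v|) ^ 2 := by gcongr
      _ = (l₀ * C ^ 2 * |v|) * |v| := by ring
      _ ≤ e * |v| := by gcongr
  have key : m p * |σ - a s₀ * v| ≤ e * (2 + k) * |v| := by
    have e1 : m p * (σ - a s₀ * v) =
        -(n p + a s₀ * m₀ * v) - l p * σ ^ 2 - a s₀ * (m p - m₀) * v := by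
      linear_combination hroot
    have hpos : 0 < m p := by linarith
    rw [← abs_of_pos hpos, ← abs_mul, e1]
    have h8 : |a s₀ * (m p - m₀) * v| ≤ k * e * |v| := by
      rw [abs_mul, abs_mul]; gcongr
    refine (abs_sub _ _).trans ((add_le_add (abs_sub _ _) le_rfl).trans ?_)
    rw [abs_neg]
    linarith
  have key2 : |σ - a s₀ * v| ≤ η / 2 * |v| := by
    refine le_of_mul_le_mul_left (a := m₀ / 2) ?_ (by positivity)
    calc m₀ / 2 * |σ - a s₀ * v| ≤ m p * |σ - a s₀ * v| := by gcongr
      _ ≤ e * (2 + k) * |v| := key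
      _ ≤ η * m₀ / 4 * |v| := by gcongr
      _ = m₀ / 2 * (η / 2 * |v|) := by ring
  have e2 : σ - a p.1 * v = (σ - a s₀ * v) - (a p.1 - a s₀) * v := by ring
  rw [e2]
  refine (abs_sub _ _).trans ?_
  rw [abs_mul]
  have : |a p.1 - a s₀| * |v| ≤ η / 2 * |v| := by gcongr
  linarith

/-- A solution of `v' = a(s) v + o(v)` stays close to the solution `v(0) exp (A(s) - A(0))` of the
linearized equation, as long as it is small. -/
lemma leaf_estimate {L δ η β B₀ : ℝ} {a A v σ : ℝ → ℝ} (hη : 0 < η)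
    (hA : ∀ s ∈ Icc 0 L, HasDerivAt A (a s) s)
    (hAB : ∀ s ∈ Icc 0 L, A s - A 0 ≤ B₀)
    (hv : ∀ s ∈ Icc 0 L, HasDerivWithinAt v (σ s) (Icc 0 L) s)
    (hσ : ∀ s ∈ Icc 0 L, |v s| ≤ δ → |σ s - a s * v s| ≤ η * |v s|)
    (hβ : 0 < β) (hv₀ : |v 0| ≤ β) (hβδ : β * Real.exp (2 * η * L) * Real.exp B₀ ≤ δ) :
    ∀ s ∈ Icc 0 L, |v s| ≤ δ ∧
      |v s * Real.exp (-(A s - A 0)) - v 0| ≤ β * (Real.exp (2 * η * s) - 1) := by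
  set E : ℝ → ℝ := fun s => Real.exp (-(A s - A 0)) with hE
  have hEpos : ∀ s, 0 < E s := fun s => Real.exp_pos _
  have hdE : ∀ s ∈ Icc 0 L, HasDerivAt E (E s * -(a s)) s := fun s hs =>
    ((hA s hs).sub_const _).neg.exp
  set u : ℝ → ℝ := fun s => v s * E s - v 0 with hu
  have hdu : ∀ s ∈ Icc 0 L, HasDerivWithinAt u ((σ s - a s * v s) * E s) (Icc 0 L) s := by
    intro s hs
    refine (((hv s hs).mul (hdE s hs).hasDerivWithinAt).sub_const _).congr_deriv ?_
    ring
  have hvu : ∀ s ∈ Icc 0 L, |u s| ≤ β * (Real.exp (2 * η * s) - 1) →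
      |v s| * E s ≤ β * Real.exp (2 * η * s) ∧ |v s| ≤ δ := by
    intro s hs h
    have h1 : |v s| * E s ≤ β * Real.exp (2 * η * s) := by
      have : v s * E s = u s + v 0 := by simp [hu]
      rw [← abs_of_pos (hEpos s), ← abs_mul, this]
      refine (abs_add_le _ _).trans ?_
      linarith
    refine ⟨h1, le_trans ?_ hβδ⟩
    have h2 : |v s| = |v s| * E s * Real.exp (A s - A 0) := by
      rw [mul_assoc, hE, ← Real.exp_add]; simp
    rw [h2]
    have h3 := hAB s hs
    have h4 : s ≤ L := hs.2
    have h5 : Real.exp (2 * η * s) ≤ Real.exp (2 * η * L) := by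
      apply Real.exp_le_exp.2; gcongr
    calc |v s| * E s * Real.exp (A s - A 0) ≤ (β * Real.exp (2 * η * L)) * Real.exp B₀ := by
          refine mul_le_mul (h1.trans (by gcongr)) (by gcongr) (by positivity) (by positivity)
      _ = _ := rfl
  -- `|u|` cannot cross the fence `β (exp (2 η s) - 1)`, below which `v` has not left the strip.
  have hbound : ∀ ⦃s⦄, s ∈ Icc 0 L → ‖u s‖ ≤ β * (Real.exp (2 * η * s) - 1) := by
    refine image_norm_le_of_norm_deriv_right_lt_deriv_boundary
      (f' := fun s => (σ s - a s * v s) * E s)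
      (B' := fun s => β * (Real.exp (2 * η * s) * (2 * η))) (fun s hs => (hdu s hs).continuousWithinAt)
      (fun s hs => (hdu s ⟨hs.1, hs.2.le⟩).mono_of_mem_nhdsWithin (Icc_mem_nhdsGE_of_mem hs))
      (by simp [hu, hE]) (fun s => ?_) ?_
    · have h1 : HasDerivAt (fun s : ℝ => 2 * η * s) (2 * η) s := by
        simpa using (hasDerivAt_id s).const_mul (2 * η)
      exact (h1.exp.sub_const 1).const_mul β
    · intro s hs hus
      rw [Real.norm_eq_abs] at hus ⊢
      have hs' : s ∈ Icc 0 L := ⟨hs.1, hs.2.le⟩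
      obtain ⟨h1, h2⟩ := hvu s hs' hus.le
      have h3 := hσ s hs' h2
      rw [abs_mul, abs_of_pos (hEpos s)]
      have h4 : 0 < β * Real.exp (2 * η * s) := by positivity
      calc |σ s - a s * v s| * E s ≤ η * |v s| * E s := by
            have := (hEpos s).le; gcongr
        _ = η * (|v s| * E s) := by ring
        _ ≤ η * (β * Real.exp (2 * η * s)) := by gcongr
        _ < β * (Real.exp (2 * η * s) * (2 * η)) := by nlinarith
  intro s hs
  exact ⟨(hvu s hs (hbound hs)).2, hbound hs⟩

/-- The derivative of the return map of `l v'² + m v' + n = 0` at the closed orbit `v = 0` is the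
multiplier `exp (∫ a)` of the linearized equation `v' = a v`, for any choice of leaves. -/
theorem hasDerivAt_return_map {l m n : ℝ × ℝ → ℝ} {a A : ℝ → ℝ} {L : ℝ} (hL : 0 ≤ L)
    (hl : ∀ s ∈ Icc 0 L, ContinuousAt l (s, 0)) (hm : ∀ s ∈ Icc 0 L, ContinuousAt m (s, 0))
    (hn : ∀ s ∈ Icc 0 L, ContDiffAt ℝ 1 n (s, 0)) (hm₀ : ∀ s ∈ Icc 0 L, 0 < m (s, 0))
    (hn₀ : ∀ s, n (s, 0) = 0) (ha : ∀ s ∈ Icc 0 L, ContinuousAt a s)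
    (han : ∀ s ∈ Icc 0 L, a s * m (s, 0) = -fderiv ℝ n (s, 0) (0, 1))
    (hA : ∀ s ∈ Icc 0 L, HasDerivAt A (a s) s) {π : ℝ → ℝ}
    (hπ : ∀ᶠ v₀ in 𝓝 (0 : ℝ), ∃ v σ : ℝ → ℝ, (∀ s ∈ Icc 0 L,
      HasDerivWithinAt v (σ s) (Icc 0 L) s ∧ IsSlope l m n (s, v s) (σ s)) ∧ v 0 = v₀ ∧
        v L = π v₀) :
    HasDerivAt π (Real.exp (A L - A 0)) 0 := by
  obtain ⟨B₀, hB₀⟩ : ∃ B₀, ∀ s ∈ Icc 0 L, A s - A 0 ≤ B₀ := by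
    have : ContinuousOn (fun s => A s - A 0) (Icc 0 L) := fun s hs =>
      ((hA s hs).continuousAt.sub continuousAt_const).continuousWithinAt
    obtain ⟨B₀, hB⟩ := (isCompact_Icc.image_of_continuousOn this).bddAbove
    exact ⟨B₀, fun s hs => hB (mem_image_of_mem _ hs)⟩
  have hLm : L ∈ Icc 0 L := ⟨hL, le_rfl⟩
  have main : ∀ η > 0, ∃ ρ > 0, ∀ v₀ β : ℝ, 0 < β → β ≤ ρ → |v₀| ≤ β →
      |π v₀ * Real.exp (-(A L - A 0)) - v₀| ≤ β * (Real.exp (2 * η * L) - 1) := by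
    intro η hη
    obtain ⟨δ, hδ, hδs⟩ := exists_strip fun s hs => eventually_slope_estimate (hl s hs) (hm s hs)
      (hn s hs) (hm₀ s hs) hn₀ (ha s hs) (han s hs) hη
    obtain ⟨ρ, hρ, hρπ⟩ := Metric.eventually_nhds_iff_ball.1 hπ
    set M := Real.exp (2 * η * L) * Real.exp B₀
    have hM : 0 < M := by positivity
    refine ⟨min (ρ / 2) (δ / M), by positivity, fun v₀ β hβ hβρ hv₀ => ?_⟩
    obtain ⟨v, σ, hv, hv0, hvL⟩ := hρπ v₀ (by
      rw [Metric.mem_ball, dist_zero_right, Real.norm_eq_abs]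
      have := hβρ.trans (min_le_left _ _); linarith)
    have := (leaf_estimate (δ := δ) hη hA hB₀ (fun s hs => (hv s hs).1)
      (fun s hs h => hδs s hs _ h _ (hv s hs).2) hβ (by rw [hv0]; exact hv₀)
      (by
        rw [mul_assoc, ← le_div_iff₀ hM]
        exact hβρ.trans (min_le_right _ _)) L hLm).2
    rwa [hvL, hv0] at this
  -- For `v₀ = 0` the estimate holds with arbitrarily small `β`.
  have hπ0 : π 0 = 0 := by
    obtain ⟨ρ, hρ, h⟩ := main 1 one_pos
    have h1 : ∀ᶠ β in 𝓝[>] (0 : ℝ), |π 0 * Real.exp (-(A L - A 0))| ≤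
        β * (Real.exp (2 * 1 * L) - 1) := by
      filter_upwards [Ioc_mem_nhdsGT hρ] with β hβ
      simpa using h 0 β hβ.1 hβ.2 (by simpa using hβ.1.le)
    have h2 : Tendsto (fun β : ℝ => β * (Real.exp (2 * 1 * L) - 1)) (𝓝[>] 0) (𝓝 0) := by
      have : Continuous (fun β : ℝ => β * (Real.exp (2 * 1 * L) - 1)) := by fun_prop
      exact (this.tendsto' 0 0 (by simp)).mono_left nhdsWithin_le_nhds
    have h3 := ge_of_tendsto h2 h1
    have h4 := abs_eq_zero.1 (le_antisymm h3 (abs_nonneg _))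
    simpa [(Real.exp_pos _).ne'] using h4
  rw [hasDerivAt_iff_isLittleO, Asymptotics.isLittleO_iff]
  intro e he
  -- The accuracy `η` is chosen so that `exp (A L - A 0) (exp (2 η L) - 1) ≤ e`.
  obtain ⟨η, hη, hηe⟩ : ∃ η > 0, Real.exp (A L - A 0) * (Real.exp (2 * η * L) - 1) ≤ e := by
    have : Continuous (fun η : ℝ => Real.exp (A L - A 0) * (Real.exp (2 * η * L) - 1)) := by
      fun_prop
    have h1 : Tendsto (fun η : ℝ => Real.exp (A L - A 0) * (Real.exp (2 * η * L) - 1)) (𝓝[>] 0)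
        (𝓝 0) := (this.tendsto' 0 0 (by simp)).mono_left nhdsWithin_le_nhds
    obtain ⟨η, h2, h3⟩ := ((h1.eventually (gt_mem_nhds he)).and self_mem_nhdsWithin).exists
    exact ⟨η, h3, le_of_lt h2⟩
  obtain ⟨ρ, hρ, h⟩ := main η hη
  filter_upwards [Metric.ball_mem_nhds (0 : ℝ) hρ] with v₀ hv₀
  rw [Metric.mem_ball, dist_zero_right, Real.norm_eq_abs] at hv₀
  rcases eq_or_ne v₀ 0 with h0 | h0
  · simp [h0]
  have h1 := h v₀ |v₀| (abs_pos.2 h0) hv₀.le le_rfl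
  simp only [hπ0, sub_zero, smul_eq_mul, Real.norm_eq_abs]
  have e1 : π v₀ - v₀ * Real.exp (A L - A 0) =
      Real.exp (A L - A 0) * (π v₀ * Real.exp (-(A L - A 0)) - v₀) := by
    have : Real.exp (A L - A 0) * Real.exp (-(A L - A 0)) = 1 := by rw [← Real.exp_add]; simp
    linear_combination (-π v₀) * this
  rw [e1, abs_mul, abs_of_pos (Real.exp_pos _)]
  calc Real.exp (A L - A 0) * |π v₀ * Real.exp (-(A L - A 0)) - v₀| ≤
      Real.exp (A L - A 0) * (|v₀| * (Real.exp (2 * η * L) - 1)) := by gcongr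
    _ = (Real.exp (A L - A 0) * (Real.exp (2 * η * L) - 1)) * |v₀| := by ring
    _ ≤ e * |v₀| := by gcongr

/-- Existence of leaves near a closed orbit: for small initial values the small root of
`l σ² + m σ + n = 0` can be integrated once around. -/
theorem exists_leaf {l m n : ℝ × ℝ → ℝ} {a A : ℝ → ℝ} {L : ℝ} (hL : 0 ≤ L)
    (hl : ∀ s ∈ Icc 0 L, ContDiffAt ℝ 1 l (s, 0)) (hm : ∀ s ∈ Icc 0 L, ContDiffAt ℝ 1 m (s, 0))
    (hn : ∀ s ∈ Icc 0 L, ContDiffAt ℝ 1 n (s, 0)) (hm₀ : ∀ s ∈ Icc 0 L, 0 < m (s, 0))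
    (hn₀ : ∀ s, n (s, 0) = 0) (ha : ∀ s ∈ Icc 0 L, ContinuousAt a s)
    (han : ∀ s ∈ Icc 0 L, a s * m (s, 0) = -fderiv ℝ n (s, 0) (0, 1))
    (hA : ∀ s ∈ Icc 0 L, HasDerivAt A (a s) s) {ρ : ℝ} (hρ : 0 < ρ) :
    ∀ᶠ v₀ in 𝓝 (0 : ℝ), ∃ v σ : ℝ → ℝ, (∀ s ∈ Icc 0 L,
      HasDerivWithinAt v (σ s) (Icc 0 L) s ∧ |v s| ≤ ρ ∧ 0 < m (s, v s) ∧
      l (s, v s) * σ s ^ 2 + m (s, v s) * σ s + n (s, v s) = 0 ∧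
      0 ≤ m (s, v s) + 2 * l (s, v s) * σ s) ∧ v 0 = v₀ := by
  obtain ⟨B₀, hB₀⟩ : ∃ B₀, ∀ s ∈ Icc 0 L, A s - A 0 ≤ B₀ := by
    have : ContinuousOn (fun s => A s - A 0) (Icc 0 L) := fun s hs =>
      ((hA s hs).continuousAt.sub continuousAt_const).continuousWithinAt
    obtain ⟨B₀, hB⟩ := (isCompact_Icc.image_of_continuousOn this).bddAbove
    exact ⟨B₀, fun s hs => hB (mem_image_of_mem _ hs)⟩
  set D : ℝ × ℝ → ℝ := fun p => m p ^ 2 - 4 * l p * n p with hD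
  -- The small root, in the form that makes sense where `l = 0`.
  set φ : ℝ × ℝ → ℝ := fun p => -2 * n p / (m p + Real.sqrt (D p)) with hφ
  have hloc : ∀ s ∈ Icc 0 L, ∀ᶠ p in 𝓝 (s, (0 : ℝ)), 0 < m p ∧ 0 < D p ∧ ContDiffAt ℝ 1 φ p ∧
      |p.2| ≤ ρ ∧ ∀ σ, IsSlope l m n p σ → |σ - a p.1 * p.2| ≤ 1 * |p.2| := by
    intro s hs
    have hDc : ContDiffAt ℝ 1 D (s, 0) :=
      ((hm s hs).pow 2).sub ((contDiffAt_const.mul (hl s hs)).mul (hn s hs))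
    have hD0 : 0 < D (s, 0) := by
      have : D (s, 0) = m (s, 0) ^ 2 := by simp [hD, hn₀]
      rw [this]
      exact pow_pos (hm₀ s hs) 2
    have hφc : ContDiffAt ℝ 1 φ (s, 0) := by
      refine (contDiffAt_const.mul (hn s hs)).div ((hm s hs).add (hDc.sqrt hD0.ne')) ?_
      exact (add_pos_of_pos_of_nonneg (hm₀ s hs) (Real.sqrt_nonneg _)).ne'
    have hr : ∀ᶠ p in 𝓝 (s, (0 : ℝ)), |p.2| ≤ ρ := by
      have : Tendsto (fun p : ℝ × ℝ => |p.2|) (𝓝 (s, 0)) (𝓝 0) := by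
        have : Continuous (fun p : ℝ × ℝ => |p.2|) := by fun_prop
        exact this.tendsto' _ _ (by simp)
      exact (this.eventually (gt_mem_nhds hρ)).mono fun p hp => le_of_lt hp
    filter_upwards [(hm s hs).continuousAt.eventually (lt_mem_nhds (hm₀ s hs)),
      hDc.continuousAt.eventually (lt_mem_nhds hD0), hφc.eventually (by simp), hr,
      eventually_slope_estimate (hl s hs).continuousAt (hm s hs).continuousAt (hn s hs) (hm₀ s hs)
        hn₀ (ha s hs) (han s hs) one_pos] with p h1 h2 h3 h4 h5
    exact ⟨h1, h2, h3, h4, h5⟩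
  have hroot : ∀ p, 0 < m p → 0 < D p → l p * φ p ^ 2 + m p * φ p + n p = 0 ∧
      0 ≤ m p + 2 * l p * φ p := by
    intro p h1 h2
    have hr := Real.sqrt_pos.2 h2
    have hr2 : Real.sqrt (D p) ^ 2 = m p ^ 2 - 4 * l p * n p := Real.sq_sqrt h2.le
    simp only [hφ]
    set r := Real.sqrt (D p)
    have h3 : m p + r ≠ 0 := by positivity
    constructor
    · field_simp
      linear_combination n p * hr2
    · have : m p + 2 * l p * (-2 * n p / (m p + r)) = r := by
        field_simp
        linear_combination -hr2
      rw [this]; exact hr.le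
  obtain ⟨δ, hδ, hstrip⟩ := exists_strip hloc
  set S : Set (ℝ × ℝ) := Icc 0 L ×ˢ Icc (-δ) δ with hS
  have hSP : ∀ p ∈ S, 0 < m p ∧ 0 < D p ∧ ContDiffAt ℝ 1 φ p ∧
      |p.2| ≤ ρ ∧ ∀ σ, IsSlope l m n p σ → |σ - a p.1 * p.2| ≤ 1 * |p.2| :=
    fun p hp => hstrip p.1 hp.1 p.2 (abs_le.2 hp.2)
  have hScpt : IsCompact S := isCompact_Icc.prod isCompact_Icc
  have hφS : ContDiffOn ℝ 1 φ S := fun p hp => (hSP p hp).2.2.1.contDiffWithinAt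
  obtain ⟨K, hK⟩ := hφS.exists_lipschitzOnWith one_ne_zero
    ((convex_Icc _ _).prod (convex_Icc _ _)) hScpt
  obtain ⟨C, hC⟩ := hScpt.exists_bound_of_continuousOn hφS.continuousOn
  -- The vector field is extended to all `v` by truncation.
  have hδ' : -δ ≤ δ := by linarith
  set ψ : ℝ → ℝ → ℝ := fun s v => φ (s, projIcc (-δ) δ hδ' v) with hψ
  have hmem : ∀ s ∈ Icc 0 L, ∀ v, ((s, (projIcc (-δ) δ hδ' v : ℝ)) : ℝ × ℝ) ∈ S := fun s hs v =>
    ⟨hs, (projIcc (-δ) δ hδ' v).2⟩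
  have hC0 : 0 ≤ C := (norm_nonneg _).trans (hC _ (hmem 0 ⟨le_rfl, hL⟩ 0))
  have hPL : ∀ v₀, IsPicardLindelof ψ (⟨0, le_rfl, hL⟩ : Icc 0 L) v₀ (C.toNNReal * L.toNNReal) 0
      C.toNNReal K := by
    intro v₀
    refine ⟨fun s hs => LipschitzOnWith.of_dist_le_mul fun v _ w _ => ?_, fun v _ => ?_,
      fun s hs v _ => ?_, ?_⟩
    · refine (hK.dist_le_mul _ (hmem s hs v) _ (hmem s hs w)).trans ?_
      gcongr
      rw [Prod.dist_eq, dist_self, max_eq_right dist_nonneg]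
      simpa [Subtype.dist_eq] using (LipschitzWith.projIcc hδ').dist_le_mul v w
    · refine hφS.continuousOn.comp (Continuous.continuousOn (by fun_prop)) fun s hs => hmem s hs v
    · rw [Real.coe_toNNReal _ hC0]
      exact hC _ (hmem s hs v)
    · simp [hC0, hL]
  have hLm : L ∈ Icc 0 L := ⟨hL, le_rfl⟩
  set M := Real.exp (2 * 1 * L) * Real.exp B₀
  have hM : 0 < M := by positivity
  filter_upwards [Metric.closedBall_mem_nhds (0 : ℝ) (show 0 < δ / M by positivity)] with v₀ hv₀
  rw [Metric.mem_closedBall, dist_zero_right, Real.norm_eq_abs] at hv₀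
  obtain ⟨v, hv0, hv⟩ := (hPL v₀).exists_eq_forall_mem_Icc_hasDerivWithinAt₀
  have hψφ : ∀ s v, |v| ≤ δ → ψ s v = φ (s, v) := fun s v h => by
    simp only [hψ, projIcc_of_mem hδ' (abs_le.1 h)]
  have hslope : ∀ s ∈ Icc 0 L, |v s| ≤ δ → |ψ s (v s) - a s * v s| ≤ 1 * |v s| := by
    intro s hs h
    rw [hψφ s _ h]
    have h1 := hstrip s hs (v s) h
    obtain ⟨h2, h3⟩ := hroot _ h1.1 h1.2.1
    refine h1.2.2.2.2 _ ⟨h2, ?_⟩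
    have h4 : 2 * n (s, v s) * φ (s, v s) + m (s, v s) * φ (s, v s) ^ 2 =
        -((m (s, v s) + 2 * l (s, v s) * φ (s, v s)) * φ (s, v s) ^ 2) := by
      linear_combination 2 * φ (s, v s) * h2
    rw [h4]
    exact neg_nonpos.2 (mul_nonneg h3 (sq_nonneg _))
  have hsmall := leaf_estimate one_pos hA hB₀ hv hslope (show 0 < δ / M by positivity)
    (by rw [hv0]; exact hv₀) (by rw [mul_assoc, div_mul_cancel₀ _ hM.ne'])
  refine ⟨v, fun s => ψ s (v s), fun s hs => ?_, hv0⟩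
  have h := (hsmall s hs).1
  have h1 := hstrip s hs (v s) h
  refine ⟨hv s hs, ?_⟩
  beta_reduce
  rw [hψφ s _ h]
  exact ⟨ h1.2.2.2.1, h1.1, hroot _ h1.1 h1.2.1⟩

/-! ### The equation of principal lines without denominators -/

section

/-- `e √(EG - F²) = det[X_u, X_v, X_uu]`. -/
def dete (X : ℝ × ℝ → E3) (p : ℝ × ℝ) : ℝ := det3 (du X p) (dv X p) (du (du X) p)

/-- `f √(EG - F²) = det[X_u, X_v, X_uv]`. -/
def detf (X : ℝ × ℝ → E3) (p : ℝ × ℝ) : ℝ := det3 (du X p) (dv X p) (dv (du X) p)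

/-- `g √(EG - F²) = det[X_u, X_v, X_vv]`. -/
def detg (X : ℝ × ℝ → E3) (p : ℝ × ℝ) : ℝ := det3 (du X p) (dv X p) (dv (dv X) p)

/-- The Gram determinant `EG - F²` of the first fundamental form. -/
def gram (X : ℝ × ℝ → E3) (p : ℝ × ℝ) : ℝ := coeffE X p * coeffG X p - coeffF X p ^ 2

/-- `(Fg - Gf) √(EG - F²)`. -/
def detL (X : ℝ × ℝ → E3) (p : ℝ × ℝ) : ℝ := coeffF X p * detg X p - coeffG X p * detf X p

/-- `(Eg - Ge) √(EG - F²)`. -/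
def detM (X : ℝ × ℝ → E3) (p : ℝ × ℝ) : ℝ := coeffE X p * detg X p - coeffG X p * dete X p

/-- `(Ef - Fe) √(EG - F²)`. -/
def detN (X : ℝ × ℝ → E3) (p : ℝ × ℝ) : ℝ := coeffE X p * detf X p - coeffF X p * dete X p

variable {X : ℝ × ℝ → E3} {p : ℝ × ℝ}

lemma detL_eq (h : 0 < gram X p) : detL X p = areaDensity X p * princL X p := by
  have : areaDensity X p ≠ 0 := (Real.sqrt_pos.2 h).ne'
  simp only [detL, princL, coeffg, coefff, detg, detf]
  field_simp

lemma detM_eq (h : 0 < gram X p) : detM X p = areaDensity X p * princM X p := by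
  have : areaDensity X p ≠ 0 := (Real.sqrt_pos.2 h).ne'
  simp only [detM, princM, coeffg, coeffe, detg, dete]
  field_simp

lemma detN_eq (h : 0 < gram X p) : detN X p = areaDensity X p * princN X p := by
  have : areaDensity X p ≠ 0 := (Real.sqrt_pos.2 h).ne'
  simp only [detN, princN, coeffe, coefff, dete, detf]
  field_simp

lemma fderiv_apply_eq (w : ℝ × ℝ) : fderiv ℝ X p w = w.1 • du X p + w.2 • dv X p := by
  have : w = w.1 • ((1 : ℝ), (0 : ℝ)) + w.2 • ((0 : ℝ), (1 : ℝ)) := by ext <;> simp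
  conv_lhs => rw [this]
  rw [map_add, map_smul, map_smul]
  rfl

lemma coeffE_pos_of_injective (h : Function.Injective (fderiv ℝ X p)) : 0 < coeffE X p := by
  refine real_inner_self_pos.2 fun h0 => ?_
  have : ((1 : ℝ), (0 : ℝ)) = 0 := h (by rw [map_zero]; exact h0)
  simp at this

lemma gram_pos_of_injective (h : Function.Injective (fderiv ℝ X p)) : 0 < gram X p := by
  have hE := coeffE_pos_of_injective h
  have h1 : 0 < ⟪fderiv ℝ X p (-coeffF X p, coeffE X p), fderiv ℝ X p (-coeffF X p, coeffE X p)⟫_ℝ := by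
    refine real_inner_self_pos.2 fun h0 => ?_
    have : (-coeffF X p, coeffE X p) = (0 : ℝ × ℝ) := h (by rw [map_zero]; exact h0)
    exact hE.ne' (congrArg Prod.snd this)
  rw [fderiv_apply_eq] at h1
  have h2 : ⟪dv X p, du X p⟫_ℝ = coeffF X p := real_inner_comm _ _
  have h3 : ⟪du X p, dv X p⟫_ℝ = coeffF X p := rfl
  have h4 : ⟪du X p, du X p⟫_ℝ = coeffE X p := rfl
  have h5 : ⟪dv X p, dv X p⟫_ℝ = coeffG X p := rfl
  simp only [inner_add_left, inner_add_right, real_inner_smul_left, real_inner_smul_right, h2, h3,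
    h4, h5] at h1
  refine pos_of_mul_pos_right (a := coeffE X p) ?_ hE.le
  rw [gram]
  linarith

lemma injective_of_gram_pos (h : 0 < gram X p) : Function.Injective (fderiv ℝ X p) := by
  rw [injective_iff_map_eq_zero]
  intro w hw
  have h1 : w.1 * coeffE X p + w.2 * coeffF X p = 0 := by
    have : ⟪du X p, fderiv ℝ X p w⟫_ℝ = 0 := by rw [hw, inner_zero_right]
    rwa [fderiv_apply_eq, inner_add_right, real_inner_smul_right, real_inner_smul_right] at this
  have h2 : w.1 * coeffF X p + w.2 * coeffG X p = 0 := by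
    have : ⟪dv X p, fderiv ℝ X p w⟫_ℝ = 0 := by rw [hw, inner_zero_right]
    rwa [fderiv_apply_eq, inner_add_right, real_inner_smul_right, real_inner_smul_right,
      real_inner_comm] at this
  rw [gram] at h
  ext
  · refine (mul_eq_zero.1 (?_ : w.1 * (coeffE X p * coeffG X p - coeffF X p ^ 2) = 0)).resolve_right
      h.ne'
    linear_combination coeffG X p * h1 - coeffF X p * h2
  · refine (mul_eq_zero.1 (?_ : w.2 * (coeffE X p * coeffG X p - coeffF X p ^ 2) = 0)).resolve_right
      h.ne'
    linear_combination coeffE X p * h2 - coeffF X p * h1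

/-- The sign by which the equation of principal lines is multiplied so that the slope of the given
foliation is the small root of the equation. -/
def Foliation.sign : Foliation → ℝ
  | .minimal => 1
  | .maximal => -1

/-- Comparison of the direction `(1, σ)` of a leaf with the direction `(1, 0)`. -/
lemma AttainsExtremum.slope_le {i : Foliation} {σ : ℝ} (h : AttainsExtremum X i p (1, σ)) :
    i.sign * (2 * princN X p * σ + princM X p * σ ^ 2) ≤ 0 := by
  cases i <;>
  · have := h (1, 0)
    simp only [secondForm, firstForm] at this
    simp only [Foliation.sign, princN, princM]
    linarith

lemma AttainsExtremum.le_slope {i : Foliation} (h : AttainsExtremum X i p (1, 0)) (σ : ℝ) :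
    0 ≤ i.sign * (2 * princN X p * σ + princM X p * σ ^ 2) := by
  cases i <;>
  · have := h (1, σ)
    simp only [secondForm, firstForm] at this
    simp only [Foliation.sign, princN, princM]
    linarith

/-- A root `σ` of the equation of principal directions at which its derivative in `σ` is
non-negative is the direction of minimal normal curvature. -/
lemma attainsExtremum_minimal {σ : ℝ}
    (h : princL X p * σ ^ 2 + princM X p * σ + princN X p = 0)
    (h' : 0 ≤ princM X p + 2 * princL X p * σ) : AttainsExtremum X .minimal p (1, σ) := by
  intro w
  -- The form comparing the two normal curvatures is the multiple `M + 2 L σ` of a square.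
  have h1 := mul_nonneg h' (sq_nonneg (w.2 - σ * w.1))
  rw [← sub_nonneg]
  refine h1.trans_eq ?_
  simp only [secondForm, firstForm]
  simp only [princL, princM, princN] at h ⊢
  linear_combination (2 * σ * w.1 ^ 2 - 2 * w.1 * w.2) * h

lemma hasDerivWithinAt_graph {J : Set ℝ} {v : ℝ → ℝ} {t σ : ℝ} (h : HasDerivWithinAt v σ J t) :
    HasDerivWithinAt (fun s => (s, v s)) (1, σ) J t :=
  (hasDerivWithinAt_id t J).prodMk h

lemma exists_slope_of_isLeaf {i : Foliation} {J : Set ℝ} {v : ℝ → ℝ} (hJ : UniqueDiffOn ℝ J)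
    (h : IsLeaf X i J fun s => (s, v s)) {t : ℝ} (ht : t ∈ J) (hg : 0 < gram X (t, v t)) :
    ∃ σ, HasDerivWithinAt v σ J t ∧
      IsSlope (fun p => i.sign * detL X p) (fun p => i.sign * detM X p)
        (fun p => i.sign * detN X p) (t, v t) σ := by
  obtain ⟨-, w, hw, -, hw'⟩ := h.1 t ht
  have h1 : HasDerivWithinAt (fun s => s) w.1 J t := by
    have := (hasFDerivAt_fst (𝕜 := ℝ) (p := (t, v t))).comp_hasDerivWithinAt t hw
    exact this
  have h2 : HasDerivWithinAt v w.2 J t := by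
    have := (hasFDerivAt_snd (𝕜 := ℝ) (p := (t, v t))).comp_hasDerivWithinAt t hw
    exact this
  have h3 : w.1 = 1 := (hJ t ht).eq_deriv _ h1 (hasDerivWithinAt_id t J)
  have h4 : AttainsExtremum X i (t, v t) w := h.2 t ht w hw
  obtain ⟨w₁, σ⟩ := w
  obtain rfl : w₁ = 1 := h3
  have hA : 0 < areaDensity X (t, v t) := Real.sqrt_pos.2 hg
  refine ⟨σ, h2, ?_, ?_⟩
  · simp only [detL_eq hg, detM_eq hg, detN_eq hg]
    linear_combination i.sign * areaDensity X (t, v t) * hw'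
  · simp only [detM_eq hg, detN_eq hg]
    have := mul_nonpos_of_nonneg_of_nonpos hA.le h4.slope_le
    linarith

lemma core_of_isLeaf {i : Foliation} (h : IsLeaf X i univ fun s => (s, (0 : ℝ))) (s : ℝ)
    (hE : 0 < coeffE X (s, 0)) (hg : 0 < gram X (s, 0)) :
    detN X (s, 0) = 0 ∧ 0 < i.sign * detM X (s, 0) := by
  have hder : HasDerivWithinAt (fun s : ℝ => (s, (0 : ℝ))) (1, 0) univ s :=
    hasDerivWithinAt_graph (hasDerivWithinAt_const s univ (0 : ℝ))
  obtain ⟨hu, w, hw, -, hw'⟩ := h.1 s (mem_univ s)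
  obtain rfl : w = (1, 0) := (uniqueDiffOn_univ s (mem_univ s)).eq_deriv _ hw hder
  have hN : princN X (s, 0) = 0 := by simpa using hw'
  have h1 := (h.2 s (mem_univ s) _ hder).le_slope 1
  -- If `M` vanished too, so would `L`, by `G N + E L = F M`.
  have hM : princM X (s, 0) ≠ 0 := by
    intro hM
    refine hu ⟨(mul_eq_zero.1 (?_ : coeffE X (s, 0) * princL X (s, 0) = 0)).resolve_left hE.ne',
      hM, hN⟩
    have e1 : coeffG X (s, 0) * princN X (s, 0) + coeffE X (s, 0) * princL X (s, 0) =
        coeffF X (s, 0) * princM X (s, 0) := by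
      simp only [princL, princM, princN]; ring
    rw [hN, hM] at e1
    linarith
  have hA : 0 < areaDensity X (s, 0) := Real.sqrt_pos.2 hg
  refine ⟨by rw [detN_eq hg, hN, mul_zero], ?_⟩
  rw [detM_eq hg]
  simp only [hN] at h1
  have h2 : 0 ≤ i.sign * princM X (s, 0) := by linarith
  have h3 : i.sign * princM X (s, 0) ≠ 0 := mul_ne_zero (by cases i <;> simp [Foliation.sign]) hM
  have h4 := mul_pos hA (lt_of_le_of_ne h2 (Ne.symm h3))
  linarith

/-- A graph whose slope is the small root of the equation of principal directions is a leaf of the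
minimal foliation. -/
lemma isLeaf_minimal {J : Set ℝ} {v σ : ℝ → ℝ} (hJ : UniqueDiffOn ℝ J)
    (h : ∀ t ∈ J, HasDerivWithinAt v (σ t) J t ∧ 0 < gram X (t, v t) ∧ 0 < detM X (t, v t) ∧
      detL X (t, v t) * σ t ^ 2 + detM X (t, v t) * σ t + detN X (t, v t) = 0 ∧
      0 ≤ detM X (t, v t) + 2 * detL X (t, v t) * σ t) :
    IsLeaf X .minimal J fun s => (s, v s) := by
  have key : ∀ t ∈ J, 0 < princM X (t, v t) ∧
      princL X (t, v t) * σ t ^ 2 + princM X (t, v t) * σ t + princN X (t, v t) = 0 ∧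
      0 ≤ princM X (t, v t) + 2 * princL X (t, v t) * σ t := by
    intro t ht
    obtain ⟨-, hg, h1, h2, h3⟩ := h t ht
    have hA : 0 < areaDensity X (t, v t) := Real.sqrt_pos.2 hg
    rw [detM_eq hg] at h1
    rw [detL_eq hg, detM_eq hg, detN_eq hg] at h2
    rw [detL_eq hg, detM_eq hg] at h3
    refine ⟨pos_of_mul_pos_right h1 hA.le, mul_left_cancel₀ hA.ne' (by linear_combination h2),
      nonneg_of_mul_nonneg_right (?_ : 0 ≤ areaDensity X (t, v t) * _) hA⟩
    linarith
  refine ⟨fun t ht => ?_, fun t ht w hw => ?_⟩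
  · obtain ⟨h1, h2, h3⟩ := key t ht
    refine ⟨fun hu => h1.ne' hu.2.1, (1, σ t), hasDerivWithinAt_graph (h t ht).1, ?_, ?_⟩
    · simp
    · linear_combination h2
  · obtain rfl : w = (1, σ t) := (hJ t ht).eq_deriv _ hw (hasDerivWithinAt_graph (h t ht).1)
    exact attainsExtremum_minimal (key t ht).2.1 (key t ht).2.2

/-! ### Partial derivatives -/

lemma _root_.ContDiffAt.du {n m : WithTop ℕ∞} (h : ContDiffAt ℝ n X p) (hmn : m + 1 ≤ n) :
    ContDiffAt ℝ m (du X) p :=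
  (h.fderiv_right hmn).clm_apply contDiffAt_const

lemma _root_.ContDiffAt.dv {n m : WithTop ℕ∞} (h : ContDiffAt ℝ n X p) (hmn : m + 1 ≤ n) :
    ContDiffAt ℝ m (dv X) p :=
  (h.fderiv_right hmn).clm_apply contDiffAt_const

lemma du_dv_comm (h : ContDiffAt ℝ 2 X p) : du (dv X) p = dv (du X) p := by
  have hd : DifferentiableAt ℝ (fderiv ℝ X) p :=
    (h.fderiv_right (m := 1) (by norm_num)).differentiableAt one_ne_zero
  have hs : IsSymmSndFDerivAt ℝ X p := h.isSymmSndFDerivAt (by simp)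
  have e : ∀ u w : ℝ × ℝ, fderiv ℝ (fun q => fderiv ℝ X q u) p w = fderiv ℝ (fderiv ℝ X) p w u := by
    intro u w
    rw [fderiv_clm_apply hd (differentiableAt_const u)]
    simp
  change fderiv ℝ (fun q => fderiv ℝ X q (0, 1)) p (1, 0) =
    fderiv ℝ (fun q => fderiv ℝ X q (1, 0)) p (0, 1)
  rw [e, e]
  exact hs _ _

lemma hasDerivAt_du {s v : ℝ} (h : DifferentiableAt ℝ X (s, v)) :
    HasDerivAt (fun s => X (s, v)) (du X (s, v)) s :=
  h.hasFDerivAt.comp_hasDerivAt s ((hasDerivAt_id s).prodMk (hasDerivAt_const s v))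

lemma hasDerivAt_dv {s v : ℝ} (h : DifferentiableAt ℝ X (s, v)) :
    HasDerivAt (fun v => X (s, v)) (dv X (s, v)) v :=
  h.hasFDerivAt.comp_hasDerivAt v ((hasDerivAt_const v s).prodMk (hasDerivAt_id v))

section Smoothness

variable {n m : WithTop ℕ∞}

lemma contDiffAt_coeffE (h : ContDiffAt ℝ n X p) (hmn : m + 1 ≤ n) : ContDiffAt ℝ m (coeffE X) p :=
  (h.du hmn).inner ℝ (h.du hmn)

lemma contDiffAt_coeffF (h : ContDiffAt ℝ n X p) (hmn : m + 1 ≤ n) : ContDiffAt ℝ m (coeffF X) p :=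
  (h.du hmn).inner ℝ (h.dv hmn)

lemma contDiffAt_coeffG (h : ContDiffAt ℝ n X p) (hmn : m + 1 ≤ n) : ContDiffAt ℝ m (coeffG X) p :=
  (h.dv hmn).inner ℝ (h.dv hmn)

lemma contDiffAt_gram (h : ContDiffAt ℝ n X p) (hmn : m + 1 ≤ n) : ContDiffAt ℝ m (gram X) p :=
  ((contDiffAt_coeffE h hmn).mul (contDiffAt_coeffG h hmn)).sub ((contDiffAt_coeffF h hmn).pow 2)

lemma contDiffAt_dete (h : ContDiffAt ℝ n X p) (hmn : m + 1 + 1 ≤ n) : ContDiffAt ℝ m (dete X) p :=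
  have hm : m + 1 ≤ n := le_self_add.trans hmn
  (h.du hm).det3 (h.dv hm) ((h.du hmn).du le_rfl)

lemma contDiffAt_detf (h : ContDiffAt ℝ n X p) (hmn : m + 1 + 1 ≤ n) : ContDiffAt ℝ m (detf X) p :=
  have hm : m + 1 ≤ n := le_self_add.trans hmn
  (h.du hm).det3 (h.dv hm) ((h.du hmn).dv le_rfl)

lemma contDiffAt_detg (h : ContDiffAt ℝ n X p) (hmn : m + 1 + 1 ≤ n) : ContDiffAt ℝ m (detg X) p :=
  have hm : m + 1 ≤ n := le_self_add.trans hmn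
  (h.du hm).det3 (h.dv hm) ((h.dv hmn).dv le_rfl)

lemma contDiffAt_detL (h : ContDiffAt ℝ n X p) (hmn : m + 1 + 1 ≤ n) : ContDiffAt ℝ m (detL X) p :=
  have hm : m + 1 ≤ n := le_self_add.trans hmn
  ((contDiffAt_coeffF h hm).mul (contDiffAt_detg h hmn)).sub
    ((contDiffAt_coeffG h hm).mul (contDiffAt_detf h hmn))

lemma contDiffAt_detM (h : ContDiffAt ℝ n X p) (hmn : m + 1 + 1 ≤ n) : ContDiffAt ℝ m (detM X) p :=
  have hm : m + 1 ≤ n := le_self_add.trans hmn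
  ((contDiffAt_coeffE h hm).mul (contDiffAt_detg h hmn)).sub
    ((contDiffAt_coeffG h hm).mul (contDiffAt_dete h hmn))

lemma contDiffAt_detN (h : ContDiffAt ℝ n X p) (hmn : m + 1 + 1 ≤ n) : ContDiffAt ℝ m (detN X) p :=
  have hm : m + 1 ≤ n := le_self_add.trans hmn
  ((contDiffAt_coeffE h hm).mul (contDiffAt_detf h hmn)).sub
    ((contDiffAt_coeffF h hm).mul (contDiffAt_dete h hmn))

end Smoothness

/-- The transversal derivative of the equation of principal lines along a principal line `v = 0` of
unit speed, through derivatives along the line. The last part says that the normal curvature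
`e` (the quotient of `dete` by the square root of `gram`) is stationary where `X_uuu` is tangent to
the surface. -/
theorem transversal_derivative (hX : ∀ s, ContDiffAt ℝ 3 X (s, 0))
    (hE : ∀ s, coeffE X (s, 0) = 1) (hg : ∀ s, 0 < gram X (s, 0)) (hN : ∀ s, detN X (s, 0) = 0)
    (s : ℝ) :
    ∃ Q' M' e' : ℝ, HasDerivAt (fun s => gram X (s, 0)) Q' s ∧
      HasDerivAt (fun s => detM X (s, 0)) M' s ∧ HasDerivAt (fun s => dete X (s, 0)) e' s ∧
      gram X (s, 0) * fderiv ℝ (detN X) (s, 0) (0, 1) =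
        gram X (s, 0) * M' - detM X (s, 0) * Q' + gram X (s, 0) ^ 2 * e'
          - gram X (s, 0) * Q' / 2 * dete X (s, 0) ∧
      (det3 (du X (s, 0)) (dv X (s, 0)) (du (du (du X)) (s, 0)) = 0 →
        2 * gram X (s, 0) * e' = Q' * dete X (s, 0)) := by
  have h3 := hX s
  have h3e : ∀ᶠ q in 𝓝 (s, (0 : ℝ)), ContDiffAt ℝ 3 X q := h3.eventually (by simp)
  have le21 : (2 : WithTop ℕ∞) + 1 ≤ 3 := by norm_num
  have le11 : (1 : WithTop ℕ∞) + 1 ≤ 2 := by norm_num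
  have dT := (h3.du le21).differentiableAt two_ne_zero
  have dY := (h3.dv le21).differentiableAt two_ne_zero
  have dT₁ := ((h3.du le21).du le11).differentiableAt one_ne_zero
  have dY₁ := ((h3.du le21).dv le11).differentiableAt one_ne_zero
  have dZ := ((h3.dv le21).dv le11).differentiableAt one_ne_zero
  have hcomm : du (dv X) =ᶠ[𝓝 (s, 0)] dv (du X) :=
    h3e.mono fun q hq => du_dv_comm (hq.of_le (by norm_num))
  have cY : du (dv X) (s, 0) = dv (du X) (s, 0) := hcomm.self_of_nhds
  have cZ : du (dv (dv X)) (s, 0) = dv (dv (du X)) (s, 0) := by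
    rw [du_dv_comm (h3.dv le21)]
    simp only [dv, hcomm.fderiv_eq]
  have cY₁ : du (dv (du X)) (s, 0) = dv (du (du X)) (s, 0) := du_dv_comm (h3.du le21)
  -- derivatives along the line
  have uT := hasDerivAt_du dT
  have uY := hasDerivAt_du dY
  have uT₁ := hasDerivAt_du dT₁
  have uY₁ := hasDerivAt_du dY₁
  have uZ := hasDerivAt_du dZ
  rw [cY] at uY
  rw [cZ] at uZ
  rw [cY₁] at uY₁
  -- derivatives across the line
  have vT := hasDerivAt_dv dT
  have vY := hasDerivAt_dv dY
  have vT₁ := hasDerivAt_dv dT₁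
  have vY₁ := hasDerivAt_dv dY₁
  set T := du X (s, 0) with hT
  set Y := dv X (s, 0) with hY
  set T₁ := du (du X) (s, 0) with hT₁
  set Y₁ := dv (du X) (s, 0) with hY₁
  set Z := dv (dv X) (s, 0) with hZ
  have iT : ⟪T, T⟫_ℝ = 1 := hE s
  have hTT₁ : ⟪T, T₁⟫_ℝ = 0 := by
    have h1 := uT.inner ℝ uT
    have h2 : (fun s => ⟪du X (s, 0), du X (s, 0)⟫_ℝ) = fun _ => (1 : ℝ) := funext hE
    rw [h2] at h1
    have h4 := h1.unique (hasDerivAt_const s (1 : ℝ))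
    rw [real_inner_comm T T₁] at h4
    linarith
  set T₂ := du (du (du X)) (s, 0) with hT₂
  set Y₂ := dv (du (du X)) (s, 0) with hY₂
  set Z₁ := dv (dv (du X)) (s, 0) with hZ₁
  have dF : HasDerivAt (fun s => coeffF X (s, 0)) (⟪T, Y₁⟫_ℝ + ⟪T₁, Y⟫_ℝ) s := uT.inner ℝ uY
  have dG : HasDerivAt (fun s => coeffG X (s, 0)) (⟪Y, Y₁⟫_ℝ + ⟪Y₁, Y⟫_ℝ) s := uY.inner ℝ uY
  have de : HasDerivAt (fun s => dete X (s, 0)) (det3 T₁ Y T₁ + det3 T Y₁ T₁ + det3 T Y T₂) s :=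
    uT.det3 uY uT₁
  have df : HasDerivAt (fun s => detf X (s, 0)) (det3 T₁ Y Y₁ + det3 T Y₁ Y₁ + det3 T Y Y₂) s :=
    uT.det3 uY uY₁
  have dg : HasDerivAt (fun s => detg X (s, 0)) (det3 T₁ Y Z + det3 T Y₁ Z + det3 T Y Z₁) s :=
    uT.det3 uY uZ
  have hfe : ∀ s, detf X (s, 0) = coeffF X (s, 0) * dete X (s, 0) := by
    intro s
    have := hN s
    rw [detN, hE] at this
    linarith
  have eF : coeffF X (s, 0) = ⟪T, Y⟫_ℝ := rfl
  have ee : dete X (s, 0) = det3 T Y T₁ := rfl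
  have hp₁ := df.unique ((dF.mul de).congr_of_eventuallyEq (Eventually.of_forall hfe))
  rw [eF, ee] at hp₁
  have dM : HasDerivAt (fun s => detM X (s, 0)) (det3 T₁ Y Z + det3 T Y₁ Z + det3 T Y Z₁ -
      ((⟪Y, Y₁⟫_ℝ + ⟪Y₁, Y⟫_ℝ) * det3 T Y T₁
        + ⟪Y, Y⟫_ℝ * (det3 T₁ Y T₁ + det3 T Y₁ T₁ + det3 T Y T₂))) s := by
    have : (fun s => detM X (s, 0)) = fun s => detg X (s, 0) - coeffG X (s, 0) * dete X (s, 0) := by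
      funext s; rw [detM, hE, one_mul]
    rw [this]
    exact dg.sub (dG.mul de)
  have dQ : HasDerivAt (fun s => gram X (s, 0)) (⟪Y, Y₁⟫_ℝ + ⟪Y₁, Y⟫_ℝ -
      2 * ⟪T, Y⟫_ℝ * (⟪T, Y₁⟫_ℝ + ⟪T₁, Y⟫_ℝ)) s := by
    have : (fun s => gram X (s, 0)) = fun s => coeffG X (s, 0) - coeffF X (s, 0) ^ 2 := by
      funext s; rw [gram, hE, one_mul]
    rw [this]
    exact (dG.sub (dF.pow 2)).congr_deriv (by rw [eF]; simp)
  have vN : HasDerivAt (fun v => detN X (s, v)) (((⟪T, Y₁⟫_ℝ + ⟪Y₁, T⟫_ℝ) * det3 T Y Y₁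
      + ⟪T, T⟫_ℝ * (det3 Y₁ Y Y₁ + det3 T Z Y₁ + det3 T Y Z₁)) -
      ((⟪T, Z⟫_ℝ + ⟪Y₁, Y⟫_ℝ) * det3 T Y T₁
        + ⟪T, Y⟫_ℝ * (det3 Y₁ Y T₁ + det3 T Z T₁ + det3 T Y Y₂))) 0 :=
    ((vT.inner ℝ vT).mul (vT.det3 vY vY₁)).sub ((vT.inner ℝ vY).mul (vT.det3 vY vT₁))
  have vN' : HasDerivAt (fun v => detN X (s, v)) (fderiv ℝ (detN X) (s, 0) (0, 1)) 0 :=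
    ((contDiffAt_detN (m := 1) h3 (by norm_num)).differentiableAt
      one_ne_zero).hasFDerivAt.comp_hasDerivAt (0 : ℝ)
      ((hasDerivAt_const (0 : ℝ) s).prodMk (hasDerivAt_id (0 : ℝ)))
  have eN := vN'.unique vN
  have eQ : gram X (s, 0) = ⟪Y, Y⟫_ℝ - ⟪T, Y⟫_ℝ ^ 2 := by rw [gram, hE, one_mul]; rfl
  have eM : detM X (s, 0) = det3 T Y Z - ⟪Y, Y⟫_ℝ * det3 T Y T₁ := by
    rw [detM, hE, one_mul]; rfl
  have hself : ∀ a : E3, det3 a Y a = 0 := fun a => by rw [det3_eq]; ring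
  have hself' : ∀ a b : E3, det3 a b b = 0 := fun a b => by rw [det3_eq]; ring
  have cT₁ : ⟪Y₁, T⟫_ℝ = ⟪T, Y₁⟫_ℝ := real_inner_comm _ _
  have cYY : ⟪Y₁, Y⟫_ℝ = ⟪Y, Y₁⟫_ℝ := real_inner_comm _ _
  have z1 := hself T₁
  have z2 := hself Y₁
  have z3 := hself' T Y₁
  obtain ⟨J1, J2⟩ := principal_jet_identity (Z := Z) (Z₁ := Z₁) (Y₂ := Y₂) (Y₁ := Y₁) (T₂ := T₂)
    iT hTT₁ (by rw [← eQ]; exact hg s) (by rw [← eF, ← ee]; exact hfe s) (by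
      linear_combination hp₁ - z3 + ⟪T, Y⟫_ℝ * z1)
  refine ⟨_, _, _, dQ, dM, de, ?_, fun h => ?_⟩
  · rw [eN, eQ, eM, ee, z1, z2, iT, cT₁]
    rw [cYY] at J1 ⊢
    linear_combination J1
  · rw [eQ, ee, z1, cYY]
    linear_combination J2 h

end

/-! ### Germs of surfaces and their return maps -/

section Germ

variable {X : ℝ × ℝ → E3} {r : ℕ∞} {L ε : ℝ} {c : ℝ → E3}

lemma IsOrientedSurfaceGerm.contDiffAt (h : IsOrientedSurfaceGerm r L c ε X) (hr : 4 ≤ r)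
    (s : ℝ) : ContDiffAt ℝ 4 X (s, 0) := by
  have hmem : (univ : Set ℝ) ×ˢ Ioo (-ε) ε ∈ 𝓝 (s, (0 : ℝ)) :=
    (isOpen_univ.prod isOpen_Ioo).mem_nhds
      ⟨mem_univ _, by simpa using h.width_pos, h.width_pos⟩
  exact (h.contDiffOn.contDiffAt hmem).of_le (WithTop.coe_le_coe.2 hr)

lemma IsOrientedSurfaceGerm.gram_pos (h : IsOrientedSurfaceGerm r L c ε X) (s : ℝ) {v : ℝ}
    (hv : v ∈ Ioo (-ε) ε) : 0 < gram X (s, v) :=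
  gram_pos_of_injective (h.immersion _ ⟨mem_univ _, hv⟩)

lemma IsOrientedSurfaceGerm.zero_mem (h : IsOrientedSurfaceGerm r L c ε X) :
    (0 : ℝ) ∈ Ioo (-ε) ε := ⟨by simpa using h.width_pos, h.width_pos⟩

/-- A directional derivative of a function that is periodic on a strip is periodic on it. -/
lemma fderiv_periodic {f : ℝ × ℝ → E3} (hf : ∀ s, ∀ v ∈ Ioo (-ε) ε, f (s + L, v) = f (s, v))
    (s : ℝ) {v : ℝ} (hv : v ∈ Ioo (-ε) ε) :
    fderiv ℝ f (s + L, v) = fderiv ℝ f (s, v) := by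
  have h1 : (s + L, v) = (s, v) + (L, (0 : ℝ)) := by ext <;> simp
  rw [h1, ← fderiv_comp_add_right]
  refine Filter.EventuallyEq.fderiv_eq ?_
  filter_upwards [(isOpen_univ.prod isOpen_Ioo).mem_nhds
    (⟨mem_univ _, hv⟩ : (s, v) ∈ (univ : Set ℝ) ×ˢ Ioo (-ε) ε)] with q hq
  rw [← hf q.1 q.2 hq.2]
  congr 1
  ext <;> simp

lemma du_periodic {f : ℝ × ℝ → E3} (hf : ∀ s, ∀ v ∈ Ioo (-ε) ε, f (s + L, v) = f (s, v)) :
    ∀ s, ∀ v ∈ Ioo (-ε) ε, du f (s + L, v) = du f (s, v) := fun s v hv => by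
  rw [du, du, fderiv_periodic hf s hv]

lemma dv_periodic {f : ℝ × ℝ → E3} (hf : ∀ s, ∀ v ∈ Ioo (-ε) ε, f (s + L, v) = f (s, v)) :
    ∀ s, ∀ v ∈ Ioo (-ε) ε, dv f (s + L, v) = dv f (s, v) := fun s v hv => by
  rw [dv, dv, fderiv_periodic hf s hv]

lemma IsOrientedSurfaceGerm.gram_periodic (h : IsOrientedSurfaceGerm r L c ε X) (s : ℝ) :
    gram X (s + L, 0) = gram X (s, 0) := by
  have h0 := h.zero_mem
  simp only [gram, coeffE, coeffF, coeffG, du_periodic h.periodic s 0 h0,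
    dv_periodic h.periodic s 0 h0]

lemma IsOrientedSurfaceGerm.detM_periodic (h : IsOrientedSurfaceGerm r L c ε X) (s : ℝ) :
    detM X (s + L, 0) = detM X (s, 0) := by
  have h0 := h.zero_mem
  simp only [detM, detg, dete, coeffE, coeffG, du_periodic h.periodic s 0 h0,
    dv_periodic h.periodic s 0 h0, du_periodic (du_periodic h.periodic) s 0 h0,
    dv_periodic (dv_periodic h.periodic) s 0 h0]

/-- Restriction of the first partial derivative to a curve `v = 0`. -/
lemma du_core {f : ℝ × ℝ → E3} {g : ℝ → E3} (hf : ∀ s, DifferentiableAt ℝ f (s, 0))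
    (hfg : ∀ s, f (s, 0) = g s) (s : ℝ) : du f (s, 0) = deriv g s := by
  have h1 := hasDerivAt_du (hf s)
  have h2 : (fun s => f (s, 0)) = g := funext hfg
  rw [h2] at h1
  exact h1.deriv.symm

lemma coeffE_core (hX : ∀ s, DifferentiableAt ℝ X (s, 0)) (hcore : ∀ s, X (s, 0) = c s)
    (hc : ∀ s, ‖deriv c s‖ = 1) (s : ℝ) : coeffE X (s, 0) = 1 := by
  rw [coeffE, du_core hX hcore, real_inner_self_eq_norm_sq, hc, one_pow]

/-- The return map of a foliation along a closed leaf: its derivative is the exponential of the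
integral of `-N_v / M`, where `M = Eg - Ge` and `N = Ef - Fe` up to a common factor. -/
theorem IsOrientedSurfaceGerm.hasDerivAt_return (h : IsOrientedSurfaceGerm r L c ε X) (hr : 4 ≤ r)
    (hc : IsClosedFrenetCurve L c) {i : Foliation} (hi : IsLeaf X i univ fun s => (s, 0))
    {A : ℝ → ℝ}
    (hA : ∀ s, HasDerivAt A (-fderiv ℝ (detN X) (s, 0) (0, 1) / detM X (s, 0)) s) {π : ℝ → ℝ}
    (hπ : IsReturnMap X L ε i π) : HasDerivAt π (Real.exp (A L - A 0)) 0 := by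
  have h4 := h.contDiffAt hr
  have le2 : (2 : WithTop ℕ∞) + 1 + 1 ≤ 4 := by norm_num
  have hE := coeffE_core (fun s => (h4 s).differentiableAt (by norm_num)) h.core hc.unit_speed
  have hcore := fun s => core_of_isLeaf hi s (by rw [hE]; exact one_pos) (h.gram_pos s h.zero_mem)
  have cL := fun s => contDiffAt_detL (h4 s) le2
  have cM := fun s => contDiffAt_detM (h4 s) le2
  have cN := fun s => contDiffAt_detN (h4 s) le2
  have hM0 : ∀ s, detM X (s, 0) ≠ 0 := fun s h0 => by simpa [h0] using (hcore s).2
  have hline : ∀ s, ContinuousAt (fun s : ℝ => (s, (0 : ℝ))) s := fun s => by fun_prop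
  refine hasDerivAt_return_map (l := fun p => i.sign * detL X p) (m := fun p => i.sign * detM X p)
    (n := fun p => i.sign * detN X p) (a := fun s => -fderiv ℝ (detN X) (s, 0) (0, 1) /
      detM X (s, 0)) hc.length_pos.le
    (fun s _ => continuousAt_const.mul (cL s).continuousAt)
    (fun s _ => continuousAt_const.mul (cM s).continuousAt)
    (fun s _ => contDiffAt_const.mul ((cN s).of_le (by norm_num))) (fun s _ => (hcore s).2)
    (fun s => by simp [(hcore s).1]) (fun s _ => ?_) (fun s _ => ?_) (fun s _ => hA s) ?_
  · have h1 : ContinuousAt (fderiv ℝ (detN X)) (s, 0) :=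
      ((cN s).fderiv_right (m := 1) (by norm_num)).continuousAt
    have h2 : ContinuousAt (fun s : ℝ => fderiv ℝ (detN X) (s, 0)) s :=
      ContinuousAt.comp (f := fun s : ℝ => (s, (0 : ℝ))) h1 (hline s)
    have h3 : ContinuousAt (fun s : ℝ => detM X (s, 0)) s :=
      ContinuousAt.comp (f := fun s : ℝ => (s, (0 : ℝ))) (cM s).continuousAt (hline s)
    exact (h2.clm_apply continuousAt_const).neg.div h3 (hM0 s)
  · have : fderiv ℝ (fun p => i.sign * detN X p) (s, 0) = i.sign • fderiv ℝ (detN X) (s, 0) :=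
      fderiv_const_mul ((cN s).differentiableAt two_ne_zero) _
    rw [this]
    have := hM0 s
    simp only [smul_apply, smul_eq_mul]
    field_simp
  · filter_upwards [hπ] with v₀ ⟨v, hv, hleaf, hv0, hvL⟩
    have hex : ∀ s ∈ Icc 0 L, ∃ σ, HasDerivWithinAt v σ (Icc 0 L) s ∧
        IsSlope (fun p => i.sign * detL X p) (fun p => i.sign * detM X p)
          (fun p => i.sign * detN X p) (s, v s) σ := fun s hs =>
      exists_slope_of_isLeaf (uniqueDiffOn_Icc hc.length_pos) hleaf hs (h.gram_pos s (hv s hs))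
    choose! σ hσ using hex
    exact ⟨v, σ, hσ, hv0, hvL⟩

end Germ

/-! ### Principal cycles along circles -/

lemma IsClosedFrenetCurve.inner_deriv {L : ℝ} {c : ℝ → E3} (hc : IsClosedFrenetCurve L c) (s : ℝ) :
    ⟪deriv c s, deriv c s⟫_ℝ = 1 := by
  rw [real_inner_self_eq_norm_sq, hc.unit_speed, one_pow]

lemma IsClosedFrenetCurve.contDiff_deriv {L : ℝ} {c : ℝ → E3} (hc : IsClosedFrenetCurve L c) :
    ContDiff ℝ (⊤ : ℕ∞) (deriv c) :=
  (contDiff_infty_iff_deriv.1 hc.smooth).2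

lemma IsClosedFrenetCurve.contDiff_deriv_deriv {L : ℝ} {c : ℝ → E3}
    (hc : IsClosedFrenetCurve L c) : ContDiff ℝ (⊤ : ℕ∞) (deriv (deriv c)) :=
  (contDiff_infty_iff_deriv.1 hc.contDiff_deriv).2

lemma IsClosedFrenetCurve.hasDerivAt {L : ℝ} {c : ℝ → E3} (hc : IsClosedFrenetCurve L c) (s : ℝ) :
    HasDerivAt c (deriv c s) s :=
  (hc.smooth.differentiable (by simp) s).hasDerivAt

lemma IsClosedFrenetCurve.hasDerivAt_deriv {L : ℝ} {c : ℝ → E3} (hc : IsClosedFrenetCurve L c)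
    (s : ℝ) : HasDerivAt (deriv c) (deriv (deriv c) s) s :=
  (hc.contDiff_deriv.differentiable (by simp) s).hasDerivAt

lemma inner_deriv_eq_zero {f g : ℝ → E3} {f' g' : E3} {s k : ℝ} (hf : HasDerivAt f f' s)
    (hg : HasDerivAt g g' s) (h : ∀ s, ⟪f s, g s⟫_ℝ = k) : ⟪f s, g'⟫_ℝ + ⟪f', g s⟫_ℝ = 0 := by
  have h1 := hf.inner ℝ hg
  rw [funext h] at h1
  exact h1.unique (hasDerivAt_const s k)

lemma IsClosedFrenetCurve.inner_deriv_deriv {L : ℝ} {c : ℝ → E3} (hc : IsClosedFrenetCurve L c)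
    (s : ℝ) : ⟪deriv c s, deriv (deriv c) s⟫_ℝ = 0 := by
  have h := inner_deriv_eq_zero (hc.hasDerivAt_deriv s) (hc.hasDerivAt_deriv s) hc.inner_deriv
  rw [real_inner_comm (deriv c s) (deriv (deriv c) s)] at h
  linarith

/-- On a circle of radius `R` the third derivative is `-R⁻² c'`. -/
lemma IsClosedFrenetCurve.third_deriv_of_isCircle {L : ℝ} {c : ℝ → E3}
    (hc : IsClosedFrenetCurve L c) (h : IsCircle (range c)) :
    ∃ μ : ℝ, ∀ s, deriv (deriv (deriv c)) s = μ • deriv c s := by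
  obtain ⟨p, n, R, hR, hn, hS⟩ := h
  have hmem : ∀ s, dist (c s) p = R ∧ ⟪n, c s - p⟫_ℝ = 0 := fun s => by
    have : c s ∈ range c := mem_range_self s
    rwa [hS] at this
  have dx : ∀ s, HasDerivAt (fun s => c s - p) (deriv c s) s := fun s =>
    (hc.hasDerivAt s).sub_const p
  have hxx : ∀ s, ⟪c s - p, c s - p⟫_ℝ = R ^ 2 := fun s => by
    rw [real_inner_self_eq_norm_sq, ← dist_eq_norm, (hmem s).1]
  have hxT : ∀ s, ⟪c s - p, deriv c s⟫_ℝ = 0 := fun s => by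
    have := inner_deriv_eq_zero (dx s) (dx s) hxx
    rw [real_inner_comm (c s - p) (deriv c s)] at this
    linarith
  have hnT : ∀ s, ⟪n, deriv c s⟫_ℝ = 0 := fun s => by
    have := inner_deriv_eq_zero (hasDerivAt_const s n) (dx s) fun s => (hmem s).2
    simpa using this
  have hnT' : ∀ s, ⟪n, deriv (deriv c) s⟫_ℝ = 0 := fun s => by
    have := inner_deriv_eq_zero (hasDerivAt_const s n) (hc.hasDerivAt_deriv s) hnT
    simpa using this
  have hxT' : ∀ s, ⟪c s - p, deriv (deriv c) s⟫_ℝ = -1 := fun s => by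
    have := inner_deriv_eq_zero (dx s) (hc.hasDerivAt_deriv s) hxT
    rw [hc.inner_deriv] at this
    linarith
  have hT' : deriv (deriv c) = fun s => -(R ^ 2)⁻¹ • (c s - p) := by
    funext s
    rw [← sub_eq_zero]
    have hTx : ⟪deriv c s, c s - p⟫_ℝ = 0 := by rw [real_inner_comm, hxT]
    refine eq_zero_of_inner_eq_zero (a := n) (b := c s - p) (c := deriv c s) ?_ ?_ ?_ ?_
    · have h1 := det3_sq n (c s - p) (deriv c s)
      rw [(hmem s).2, hnT, hxT, hxx, hc.inner_deriv] at h1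
      have h2 : 0 < ⟪n, n⟫_ℝ := real_inner_self_pos.2 hn
      intro h0
      rw [h0] at h1
      have : 0 < ⟪n, n⟫_ℝ * R ^ 2 := by positivity
      linarith
    · rw [inner_sub_right, hnT', real_inner_smul_right, (hmem s).2]; simp
    · rw [inner_sub_right, hxT', real_inner_smul_right, hxx]
      field_simp; ring
    · rw [inner_sub_right, hc.inner_deriv_deriv, real_inner_smul_right, hTx]; simp
  refine ⟨-(R ^ 2)⁻¹, fun s => ?_⟩
  rw [hT']
  exact ((dx s).const_smul (-(R ^ 2)⁻¹)).deriv

/-- A circle is not a hyperbolic principal cycle: its normal curvature is constant, so that the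
multiplier of the return map is the exponential of the integral of an exact derivative. -/
theorem IsClosedFrenetCurve.not_hyperbolic_of_isCircle {r : ℕ∞} (hr : 4 ≤ r) {L ε : ℝ}
    {c : ℝ → E3} {X : ℝ × ℝ → E3} (hc : IsClosedFrenetCurve L c) (hcirc : IsCircle (range c))
    (h : IsOrientedSurfaceGerm r L c ε X) : ¬ IsHyperbolicPrincipalCycle X L ε := by
  rintro ⟨i, hi, π, d, hπ, hd, hd1⟩
  obtain ⟨μ, hμ⟩ := hc.third_deriv_of_isCircle hcirc
  have h4 := h.contDiffAt hr
  have hg : ∀ s, 0 < gram X (s, 0) := fun s => h.gram_pos s h.zero_mem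
  have d0 : ∀ s, DifferentiableAt ℝ X (s, 0) := fun s => (h4 s).differentiableAt (by norm_num)
  have le3 : (3 : WithTop ℕ∞) + 1 ≤ 4 := by norm_num
  have le2 : (2 : WithTop ℕ∞) + 1 ≤ 3 := by norm_num
  have e1 := du_core d0 h.core
  have e2 := du_core (fun s => ((h4 s).du le3).differentiableAt (by norm_num)) e1
  have e3 := du_core (fun s => (((h4 s).du le3).du le2).differentiableAt (by norm_num)) e2
  have hE := coeffE_core d0 h.core hc.unit_speed
  have hcore := fun s => core_of_isLeaf hi s (by rw [hE]; exact one_pos) (hg s)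
  have hM0 : ∀ s, detM X (s, 0) ≠ 0 := fun s h0 => by simpa [h0] using (hcore s).2
  have hA : ∀ s, HasDerivAt (fun s => Real.log (gram X (s, 0)) - Real.log (detM X (s, 0)))
      (-fderiv ℝ (detN X) (s, 0) (0, 1) / detM X (s, 0)) s := by
    intro s
    obtain ⟨Q', M', e', hQ, hM, -, hN, he⟩ := transversal_derivative
      (fun s => (h4 s).of_le (by norm_num)) hE hg (fun s => (hcore s).1) s
    have he' := he (by
      rw [e3, hμ, e1, det3_eq]
      simp only [PiLp.smul_apply, smul_eq_mul]; ring)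
    refine ((hQ.log (hg s).ne').sub (hM.log (hM0 s))).congr_deriv ?_
    have h1 := hM0 s
    have h2 := (hg s).ne'
    field_simp
    linear_combination hN + gram X (s, 0) / 2 * he'
  have hper : Real.log (gram X (L, 0)) - Real.log (detM X (L, 0)) -
      (Real.log (gram X (0, 0)) - Real.log (detM X (0, 0))) = 0 := by
    have h1 := h.gram_periodic 0
    have h2 := h.detM_periodic 0
    rw [zero_add] at h1 h2
    rw [h1, h2, sub_self]
  have h1 := h.hasDerivAt_return hr hc hi hA hπ
  rw [hper, Real.exp_zero] at h1
  exact hd1 (hd.unique h1)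

/-! ### Parallel normal fields along planar and spherical curves -/

section

/-- `q` is a unit normal field along `c`, with `q' = l c'` for a constant `l`. -/
structure IsParallelNormal (L : ℝ) (c : ℝ → E3) (l : ℝ) (q : ℝ → E3) : Prop where
  smooth : ContDiff ℝ (⊤ : ℕ∞) q
  periodic : Function.Periodic q L
  unit : ∀ s, ⟪q s, q s⟫_ℝ = 1
  normal : ∀ s, ⟪deriv c s, q s⟫_ℝ = 0
  deriv_eq : ∀ s, HasDerivAt q (l • deriv c s) s

variable {L l : ℝ} {c q : ℝ → E3}

/-- For a planar curve `q` is the unit normal of the plane. -/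
lemma IsClosedFrenetCurve.exists_parallel_of_coplanar (hc : IsClosedFrenetCurve L c)
    (h : Coplanar ℝ (range c)) : ∃ l q, IsParallelNormal L c l q := by
  obtain ⟨n, hn, hn0⟩ : ∃ n ∈ (vectorSpan ℝ (range c))ᗮ, n ≠ 0 := by
    refine Submodule.exists_mem_ne_zero_of_ne_bot fun hbot => ?_
    rw [Submodule.orthogonal_eq_bot_iff] at hbot
    have h1 := h.finrank_le_two
    rw [hbot, finrank_top, finrank_euclideanSpace_fin] at h1
    omega
  have hnc : ∀ s, ⟪n, c s - c 0⟫_ℝ = 0 := fun s =>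
    (Submodule.mem_orthogonal' _ _).1 hn _
      (vsub_mem_vectorSpan ℝ (mem_range_self s) (mem_range_self 0))
  have hnT : ∀ s, ⟪deriv c s, n⟫_ℝ = 0 := fun s => by
    have := inner_deriv_eq_zero (hasDerivAt_const s n) ((hc.hasDerivAt s).sub_const (c 0)) hnc
    rw [real_inner_comm]
    simpa using this
  refine ⟨0, fun _ => ‖n‖⁻¹ • n, contDiff_const, fun _ => rfl, fun s => ?_, fun s => ?_,
    fun s => ?_⟩
  · rw [real_inner_smul_left, real_inner_smul_right, real_inner_self_eq_norm_sq]
    have : ‖n‖ ≠ 0 := norm_ne_zero_iff.2 hn0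
    field_simp
  · rw [real_inner_smul_right, hnT, mul_zero]
  · rw [zero_smul]; exact hasDerivAt_const _ _

/-- For a spherical curve `q` is the unit normal of the sphere. -/
lemma IsClosedFrenetCurve.exists_parallel_of_cospherical (hc : IsClosedFrenetCurve L c)
    (h : EuclideanGeometry.Cospherical (range c)) : ∃ l q, IsParallelNormal L c l q := by
  obtain ⟨p, R, hp⟩ := h
  have hp : ∀ s, dist (c s) p = R := fun s => hp _ (mem_range_self s)
  have dx : ∀ s, HasDerivAt (fun s => c s - p) (deriv c s) s := fun s =>
    (hc.hasDerivAt s).sub_const p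
  have hxx : ∀ s, ⟪c s - p, c s - p⟫_ℝ = R ^ 2 := fun s => by
    rw [real_inner_self_eq_norm_sq, ← dist_eq_norm, hp]
  have hxT : ∀ s, ⟪deriv c s, c s - p⟫_ℝ = 0 := fun s => by
    have := inner_deriv_eq_zero (dx s) (dx s) hxx
    rw [real_inner_comm (deriv c s)] at this
    linarith
  have hR : R ≠ 0 := by
    rintro rfl
    have h1 : c = fun _ => p := funext fun s => dist_eq_zero.1 (hp s)
    have h2 := hc.unit_speed 0
    rw [h1] at h2
    simp at h2
  refine ⟨R⁻¹, fun s => R⁻¹ • (c s - p), (hc.smooth.sub contDiff_const).const_smul R⁻¹,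
    fun s => ?_, fun s => ?_, fun s => ?_, fun s => (dx s).const_smul R⁻¹⟩
  · simp only [hc.periodic s]
  · rw [real_inner_smul_left, real_inner_smul_right, hxx]
    field_simp
  · rw [real_inner_smul_right, hxT, mul_zero]

/-- The normal curvature of `c` in the direction of `c' × q`, which is the geodesic curvature of
`c` in the plane or sphere with normal `q`. -/
def parallelCurvature (c q : ℝ → E3) (s : ℝ) : ℝ := det3 (deriv c s) (q s) (deriv (deriv c) s)

lemma deriv_periodic {E : Type*} [NormedAddCommGroup E] [NormedSpace ℝ E] {f : ℝ → E}
    (h : Function.Periodic f L) : Function.Periodic (deriv f) L := fun s => by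
  rw [← deriv_comp_add_const, h.funext]

lemma IsParallelNormal.contDiff_curvature (hq : IsParallelNormal L c l q)
    (hc : IsClosedFrenetCurve L c) : ContDiff ℝ (⊤ : ℕ∞) (parallelCurvature c q) :=
  contDiff_iff_contDiffAt.2 fun _ =>
    hc.contDiff_deriv.contDiffAt.det3 hq.smooth.contDiffAt hc.contDiff_deriv_deriv.contDiffAt

lemma IsParallelNormal.periodic_curvature (hq : IsParallelNormal L c l q)
    (hc : IsClosedFrenetCurve L c) : Function.Periodic (parallelCurvature c q) L := fun s => by
  simp only [parallelCurvature, deriv_periodic hc.periodic s, hq.periodic s,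
    deriv_periodic (deriv_periodic hc.periodic) s]

lemma cross_cross_right (a b : E3) : cross (cross a b) b = ⟪a, b⟫_ℝ • b - ⟪b, b⟫_ℝ • a := by
  refine E3.ext_coord ?_ ?_ ?_ <;>
  · simp only [inner_eq, cross_zero', cross_one', cross_two', PiLp.sub_apply, PiLp.smul_apply,
      smul_eq_mul]
    ring

lemma IsParallelNormal.deriv_tangent (hq : IsParallelNormal L c l q)
    (hc : IsClosedFrenetCurve L c) (s : ℝ) : deriv (deriv c) s =
      -l • q s + parallelCurvature c q s • cross (deriv c s) (q s) := by
  have h1 := frame_expansion (hc.inner_deriv s) (hq.unit s) (hq.normal s) (deriv (deriv c) s)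
  have h2 := inner_deriv_eq_zero (hc.hasDerivAt_deriv s) (hq.deriv_eq s) hq.normal
  rw [real_inner_smul_right, hc.inner_deriv, real_inner_comm (q s)] at h2
  have h3 : ⟪q s, deriv (deriv c) s⟫_ℝ = -l := by linarith
  rw [hc.inner_deriv_deriv, h3, zero_smul, zero_add] at h1
  exact h1

/-- If the curvature with respect to a parallel normal is constant, then `c''' = -ω² c'`. -/
lemma IsParallelNormal.third_deriv (hq : IsParallelNormal L c l q) (hc : IsClosedFrenetCurve L c)
    {k : ℝ} (hk : ∀ s, parallelCurvature c q s = k) :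
    ∃ ω : ℝ, 0 < ω ∧ ∀ s, HasDerivAt (deriv (deriv c)) (-(ω ^ 2) • deriv c s) s := by
  have hT' : deriv (deriv c) = fun s => -l • q s + k • cross (deriv c s) (q s) := by
    funext s; rw [hq.deriv_tangent hc, hk]
  have hω : 0 < k ^ 2 + l ^ 2 := by
    by_contra h0
    have hk0 : k = 0 := by nlinarith [sq_nonneg k, sq_nonneg l]
    have hl0 : l = 0 := by nlinarith [sq_nonneg k, sq_nonneg l]
    have := hc.curvature_pos 0
    rw [hT', hk0, hl0] at this
    simp at this
  refine ⟨Real.sqrt (k ^ 2 + l ^ 2), Real.sqrt_pos.2 hω, fun s => ?_⟩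
  rw [Real.sq_sqrt hω.le]
  have hN : HasDerivAt (fun s => cross (deriv c s) (q s)) (-k • deriv c s) s := by
    refine ((hc.hasDerivAt_deriv s).cross (hq.deriv_eq s)).congr_deriv ?_
    have h1 : cross (deriv c s) (l • deriv c s) = 0 := by
      refine E3.ext_coord ?_ ?_ ?_ <;> simp <;> ring
    have h2 : cross (-l • q s + k • cross (deriv c s) (q s)) (q s) =
        k • cross (cross (deriv c s) (q s)) (q s) := by
      refine E3.ext_coord ?_ ?_ ?_ <;> simp <;> ring
    rw [h1, hT']
    simp only
    rw [h2, cross_cross_right, hq.normal, hq.unit]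
    simp
  rw [hT']
  refine (((hq.deriv_eq s).const_smul (-l)).add (hN.const_smul k)).congr_deriv ?_
  rw [smul_smul, smul_smul, ← add_smul]
  congr 1
  ring

lemma exists_cos_sin {x y : ℝ} (h : x ^ 2 + y ^ 2 = 1) : ∃ θ, Real.cos θ = x ∧ Real.sin θ = y := by
  have hn : ‖(⟨x, y⟩ : ℂ)‖ = 1 := by
    rw [Complex.norm_def, Complex.normSq_mk, Real.sqrt_eq_one]; linarith
  have h0 : (⟨x, y⟩ : ℂ) ≠ 0 := fun h0 => by rw [h0] at hn; simp at hn
  refine ⟨Complex.arg ⟨x, y⟩, ?_, ?_⟩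
  · rw [Complex.cos_arg h0, hn, div_one]
  · rw [Complex.sin_arg, hn, div_one]

/-- A closed curve of unit speed with `c''' = -ω² c'` is a circle of radius `1 / ω`. -/
lemma IsClosedFrenetCurve.isCircle_of_third_deriv (hc : IsClosedFrenetCurve L c) {ω : ℝ}
    (hω : 0 < ω) (h : ∀ s, HasDerivAt (deriv (deriv c)) (-(ω ^ 2) • deriv c s) s) :
    IsCircle (range c) := by
  set T := deriv c with hT
  set K := deriv T with hK
  have hconst : ∀ f : ℝ → E3, (∀ s, HasDerivAt f 0 s) → ∀ s, f s = f 0 := fun f hf s =>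
    is_const_of_deriv_eq_zero (fun s => (hf s).differentiableAt) (fun s => (hf s).deriv) s 0
  set P : E3 := c 0 + (ω ^ 2)⁻¹ • K 0 with hP
  have hcP : ∀ s, c s - P = -(ω ^ 2)⁻¹ • K s := by
    have h1 := hconst (fun s => c s + (ω ^ 2)⁻¹ • K s) fun s => by
      refine ((hc.hasDerivAt s).add ((h s).const_smul (ω ^ 2)⁻¹)).congr_deriv ?_
      rw [smul_smul, mul_neg, inv_mul_cancel₀ (by positivity), neg_one_smul, add_neg_cancel]
    intro s
    rw [hP, ← h1 s]
    simp
  have hcos : ∀ s, HasDerivAt (fun s => Real.cos (ω * s)) (-Real.sin (ω * s) * ω) s := fun s => by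
    simpa using ((hasDerivAt_id s).const_mul ω).cos
  have hsin : ∀ s, HasDerivAt (fun s => Real.sin (ω * s)) (Real.cos (ω * s) * ω) s := fun s => by
    simpa using ((hasDerivAt_id s).const_mul ω).sin
  have dT : ∀ s, HasDerivAt T (K s) s := hc.hasDerivAt_deriv
  have hU : ∀ s, (ω * Real.cos (ω * s)) • T s - Real.sin (ω * s) • K s = ω • T 0 := by
    intro s
    have := hconst (fun s => (ω * Real.cos (ω * s)) • T s - Real.sin (ω * s) • K s) (fun s => by
      refine ((((hcos s).const_mul ω).smul (dT s)).sub ((hsin s).smul (h s))).congr_deriv ?_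
      module) s
    simpa using this
  have hV : ∀ s, (ω * Real.sin (ω * s)) • T s + Real.cos (ω * s) • K s = K 0 := by
    intro s
    have := hconst (fun s => (ω * Real.sin (ω * s)) • T s + Real.cos (ω * s) • K s) (fun s => by
      refine ((((hsin s).const_mul ω).smul (dT s)).add ((hcos s).smul (h s))).congr_deriv ?_
      module) s
    simpa using this
  have hKs : ∀ s, K s = Real.cos (ω * s) • K 0 - (ω * Real.sin (ω * s)) • T 0 := by
    intro s
    have h1 := Real.cos_sq_add_sin_sq (ω * s)
    have e : Real.cos (ω * s) • K 0 - Real.sin (ω * s) • (ω • T 0) = K s := by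
      rw [← hU s, ← hV s]
      calc _ = (Real.cos (ω * s) ^ 2 + Real.sin (ω * s) ^ 2) • K s := by module
        _ = K s := by rw [h1, one_smul]
    rw [← e, smul_smul, mul_comm (Real.sin _)]
  have hTT : ∀ s, ⟪T s, T s⟫_ℝ = 1 := hc.inner_deriv
  have hTK : ∀ s, ⟪T s, K s⟫_ℝ = 0 := hc.inner_deriv_deriv
  have hKT : ∀ s, ⟪K s, T s⟫_ℝ = 0 := fun s => by rw [real_inner_comm]; exact hTK s
  have hKK : ∀ s, ⟪K s, K s⟫_ℝ = ω ^ 2 := fun s => by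
    have := inner_deriv_eq_zero (dT s) (h s) hTK
    rw [real_inner_smul_right, hTT] at this
    linarith
  refine ⟨P, cross (T 0) (K 0), 1 / ω, by positivity, ?_, ?_⟩
  · intro h0
    have := inner_cross_cross (T 0) (K 0)
    rw [h0, inner_zero_left, hTT, hKK, hTK] at this
    have : 0 < ω ^ 2 := by positivity
    linarith
  · ext x
    simp only [mem_range, mem_ofPred_eq]
    constructor
    · rintro ⟨s, rfl⟩
      constructor
      · rw [dist_eq_norm, hcP, norm_smul]
        have : ‖K s‖ = ω := by
          rw [← sq_eq_sq₀ (norm_nonneg _) hω.le, ← real_inner_self_eq_norm_sq, hKK]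
        rw [this, norm_neg, norm_inv, Real.norm_eq_abs, abs_of_pos (by positivity)]
        field_simp
      · rw [hcP, hKs s, real_inner_smul_right, inner_sub_right, real_inner_smul_right,
          real_inner_smul_right, real_inner_comm (K 0), real_inner_comm (T 0), inner_left_cross,
          inner_right_cross]
        simp
    · rintro ⟨h1, h2⟩
      have hb : ⟪ω⁻¹ • K 0, ω⁻¹ • K 0⟫_ℝ = 1 := by
        rw [real_inner_smul_left, real_inner_smul_right, hKK]; field_simp
      have hTb : ⟪T 0, ω⁻¹ • K 0⟫_ℝ = 0 := by rw [real_inner_smul_right, hTK, mul_zero]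
      have hexp := frame_expansion (hTT 0) hb hTb (x - P)
      have h3 : det3 (T 0) (ω⁻¹ • K 0) (x - P) = 0 := by
        have : det3 (T 0) (ω⁻¹ • K 0) (x - P) = ω⁻¹ * det3 (T 0) (K 0) (x - P) := by
          simp only [det3_eq, PiLp.smul_apply, smul_eq_mul]; ring
        rw [this, ← inner_cross, h2, mul_zero]
      rw [h3, zero_smul, add_zero] at hexp
      set α := ⟪T 0, x - P⟫_ℝ
      set β := ⟪ω⁻¹ • K 0, x - P⟫_ℝ
      have hbT : ⟪ω⁻¹ • K 0, T 0⟫_ℝ = 0 := by rw [real_inner_comm]; exact hTb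
      have h4 : α ^ 2 + β ^ 2 = (1 / ω) ^ 2 := by
        rw [← h1, dist_eq_norm, ← real_inner_self_eq_norm_sq, hexp]
        simp only [inner_add_left, inner_add_right, real_inner_smul_left, hTT, hKT, hTK,
          real_inner_smul_right, hKK]
        field_simp
        ring
      obtain ⟨θ, hθ1, hθ2⟩ := exists_cos_sin (x := -ω * β) (y := ω * α) (by
        have : (-ω * β) ^ 2 + (ω * α) ^ 2 = ω ^ 2 * (α ^ 2 + β ^ 2) := by ring
        rw [this, h4]; field_simp)
      refine ⟨θ / ω, ?_⟩
      rw [← sub_left_inj (a := P), hcP, hKs, hexp, mul_div_cancel₀ _ hω.ne', hθ1, hθ2]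
      have e1 : -(ω ^ 2)⁻¹ * (-ω * β) = β * ω⁻¹ := by field_simp
      have e2 : -(ω ^ 2)⁻¹ * (ω * (ω * α)) = -α := by field_simp
      rw [smul_sub, smul_smul, smul_smul, smul_smul, e1, e2]
      module

end

/-! ### Embedded annuli around a closed curve -/

section

/-- A map with injective strict derivative at a point is injective near the point. -/
lemma exists_injOn_of_injective_fderiv {X : ℝ × ℝ → E3} {p : ℝ × ℝ} (hX : ContDiffAt ℝ 1 X p)
    (h : Function.Injective (fderiv ℝ X p)) : ∃ U ∈ 𝓝 p, InjOn X U := by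
  obtain ⟨g, hg⟩ := LinearMap.exists_leftInverse_of_injective (fderiv ℝ X p : ℝ × ℝ →ₗ[ℝ] E3)
    (LinearMap.ker_eq_bot.2 h)
  set G : E3 →L[ℝ] ℝ × ℝ := LinearMap.toContinuousLinearMap g
  have h1 : HasStrictFDerivAt (fun q => G (X q))
      ((ContinuousLinearEquiv.refl ℝ (ℝ × ℝ) : (ℝ × ℝ) ≃L[ℝ] (ℝ × ℝ)) : ℝ × ℝ →L[ℝ] ℝ × ℝ) p := by
    refine (G.hasStrictFDerivAt.comp p (hX.hasStrictFDerivAt one_ne_zero)).congr_fderiv ?_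
    refine ContinuousLinearMap.ext fun w => ?_
    exact LinearMap.congr_fun hg w
  refine ⟨_, (h1.toOpenPartialHomeomorph _).open_source.mem_nhds
    h1.mem_toOpenPartialHomeomorph_source, fun x hx y hy hxy => ?_⟩
  exact (h1.toOpenPartialHomeomorph _).injOn hx hy (by simp [hxy])

variable {X : ℝ × ℝ → E3} {L : ℝ} {c : ℝ → E3}

/-- A periodic map that is an immersion along a simple closed curve is an embedding near it. -/
lemma IsClosedFrenetCurve.exists_embedded (hc : IsClosedFrenetCurve L c)
    (hX : ContDiff ℝ (⊤ : ℕ∞) X) (hper : ∀ s v, X (s + L, v) = X (s, v))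
    (hcore : ∀ s, X (s, 0) = c s) (himm : ∀ s, Function.Injective (fderiv ℝ X (s, 0))) :
    ∃ ε > 0, InjOn X (Ico 0 L ×ˢ Ioo (-ε) ε) := by
  have hinj : ∀ s, ∃ U ∈ 𝓝 (s, (0 : ℝ)), InjOn X U := fun s =>
    exists_injOn_of_injective_fderiv (hX.contDiffAt.of_le (by exact_mod_cast le_top)) (himm s)
  have hL := hc.length_pos
  -- Near a point of the double annulus, coincident points have equal parameters modulo `L`.
  have hloc : ∀ y ∈ Icc (0 : ℝ) L ×ˢ Icc (0 : ℝ) L,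
      ∀ᶠ z : (ℝ × ℝ) × (ℝ × ℝ) in 𝓝 ((0, 0), y), z.2.1 ∈ Ico 0 L → z.2.2 ∈ Ico 0 L →
        X (z.2.1, z.1.1) = X (z.2.2, z.1.2) → (z.2.1, z.1.1) = (z.2.2, z.1.2) := by
    rintro ⟨a, b⟩ ⟨ha, hb⟩
    change a ∈ Icc 0 L at ha
    change b ∈ Icc 0 L at hb
    have c1 : Continuous (fun z : (ℝ × ℝ) × (ℝ × ℝ) => (z.2.1, z.1.1)) := by fun_prop
    have c2 : Continuous (fun z : (ℝ × ℝ) × (ℝ × ℝ) => (z.2.2, z.1.2)) := by fun_prop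
    have c1' : Continuous (fun z : (ℝ × ℝ) × (ℝ × ℝ) => (z.2.1 - L, z.1.1)) := by fun_prop
    have c2' : Continuous (fun z : (ℝ × ℝ) × (ℝ × ℝ) => (z.2.2 - L, z.1.2)) := by fun_prop
    have hper' : ∀ s v, X (s - L, v) = X (s, v) := fun s v => by
      rw [← hper (s - L) v, sub_add_cancel]
    by_cases hab : c a = c b
    · have hcase : a = b ∨ (a = 0 ∧ b = L) ∨ (a = L ∧ b = 0) := by
        have hc0 : c L = c 0 := by simpa using hc.periodic 0
        rcases ha.2.lt_or_eq with h1 | h1 <;> rcases hb.2.lt_or_eq with h2 | h2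
        · exact Or.inl (hc.simple ⟨ha.1, h1⟩ ⟨hb.1, h2⟩ hab)
        · refine Or.inr (Or.inl ⟨hc.simple ⟨ha.1, h1⟩ ⟨le_rfl, hL⟩ ?_, h2⟩)
          rw [hab, h2, hc0]
        · refine Or.inr (Or.inr ⟨h1, hc.simple ⟨hb.1, h2⟩ ⟨le_rfl, hL⟩ ?_⟩)
          rw [← hab, h1, hc0]
        · exact Or.inl (h1.trans h2.symm)
      rcases hcase with rfl | ⟨rfl, rfl⟩ | ⟨rfl, rfl⟩
      · obtain ⟨U, hU, hUi⟩ := hinj a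
        filter_upwards [c1.continuousAt.preimage_mem_nhds (x := ((0, 0), (a, a))) hU,
          c2.continuousAt.preimage_mem_nhds (x := ((0, 0), (a, a))) hU] with z h1 h2 _ _ h3
        exact hUi h1 h2 h3
      · obtain ⟨U, hU, hUi⟩ := hinj 0
        filter_upwards [c1.continuousAt.preimage_mem_nhds (x := ((0, 0), (0, b))) hU,
          c2'.continuousAt.preimage_mem_nhds (x := ((0, 0), (0, b)))
            (by simpa using hU)] with z h1 h2 h4 h5 h3
        have := congrArg Prod.fst (hUi h1 h2 (h3.trans (hper' _ _).symm))
        simp only at this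
        linarith [h4.1, h5.2]
      · obtain ⟨U, hU, hUi⟩ := hinj 0
        filter_upwards [c1'.continuousAt.preimage_mem_nhds (x := ((0, 0), (a, 0)))
            (by simpa using hU),
          c2.continuousAt.preimage_mem_nhds (x := ((0, 0), (a, 0))) hU] with z h1 h2 h4 h5 h3
        have := congrArg Prod.fst (hUi h1 h2 ((hper' _ _).trans h3))
        simp only at this
        linarith [h4.2, h5.1]
    · have hne : X (a, 0) ≠ X (b, 0) := by rwa [hcore, hcore]
      have k1 : ContinuousAt (fun z : (ℝ × ℝ) × (ℝ × ℝ) => X (z.2.1, z.1.1)) ((0, 0), (a, b)) :=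
        (hX.continuous.comp c1).continuousAt
      have k2 : ContinuousAt (fun z : (ℝ × ℝ) × (ℝ × ℝ) => X (z.2.2, z.1.2)) ((0, 0), (a, b)) :=
        (hX.continuous.comp c2).continuousAt
      filter_upwards [k1.ne_iff_eventually_ne k2 |>.1 hne] with z hz _ _ h
      exact absurd h hz
  have h1 := (isCompact_Icc.prod isCompact_Icc).eventually_forall_of_forall_eventually
    (P := fun (v y : ℝ × ℝ) => y.1 ∈ Ico 0 L → y.2 ∈ Ico 0 L → X (y.1, v.1) = X (y.2, v.2) →
      (y.1, v.1) = (y.2, v.2)) hloc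
  obtain ⟨ε, hε, h2⟩ := Metric.eventually_nhds_iff_ball.1 h1
  refine ⟨ε, hε, ?_⟩
  rintro ⟨s, v⟩ ⟨hs, hv⟩ ⟨s', v'⟩ ⟨hs', hv'⟩ h
  refine h2 (v, v') ?_ (s, s') ⟨Ico_subset_Icc_self hs, Ico_subset_Icc_self hs'⟩ hs hs' h
  rw [Metric.mem_ball, Prod.dist_eq]
  simp only [dist_zero_right, Real.norm_eq_abs, max_lt_iff]
  exact ⟨abs_lt.2 hv, abs_lt.2 hv'⟩

/-- A smooth periodic map that is an immersion along its core represents a germ of an embedded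
surface. -/
lemma IsClosedFrenetCurve.exists_germ (hc : IsClosedFrenetCurve L c) (r : ℕ∞)
    (hX : ContDiff ℝ (⊤ : ℕ∞) X) (hper : ∀ s v, X (s + L, v) = X (s, v))
    (hcore : ∀ s, X (s, 0) = c s) (hg : ∀ s, 0 < gram X (s, 0)) :
    ∃ ε, IsOrientedSurfaceGerm r L c ε X := by
  obtain ⟨ε₁, hε₁, hinj⟩ := hc.exists_embedded hX hper hcore fun s => injective_of_gram_pos (hg s)
  have hgc : Continuous (gram X) := continuous_iff_continuousAt.2 fun p =>
    (contDiffAt_gram (m := 0) (n := 1) (hX.contDiffAt.of_le (by exact_mod_cast le_top))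
      (by norm_num)).continuousAt
  obtain ⟨ε₂, hε₂, hpos⟩ := exists_strip (L := L) (P := fun p => 0 < gram X p) fun s _ =>
    hgc.continuousAt.eventually (lt_mem_nhds (hg s))
  refine ⟨min ε₁ ε₂, lt_min hε₁ hε₂, (hX.of_le (by exact_mod_cast le_top)).contDiffOn,
    fun s v _ => hper s v, ?_, hinj.mono ?_, hcore⟩
  · rintro ⟨s, v⟩ ⟨-, hv⟩
    obtain ⟨s', hs', he⟩ := Function.Periodic.exists_mem_Ico₀
      (f := fun s => fderiv ℝ X (s, v)) (c := L)
      (fun s => fderiv_periodic (fun s v _ => hper s v) s hv) hc.length_pos s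
    change fderiv ℝ X (s, v) = fderiv ℝ X (s', v) at he
    rw [he]
    exact injective_of_gram_pos (hpos s' (Ico_subset_Icc_self hs') v
      ((abs_lt.2 hv).le.trans (min_le_right _ _)))
  · refine prod_mono le_rfl (Ioo_subset_Ioo ?_ (min_le_left _ _))
    exact neg_le_neg (min_le_left _ _)

end

/-! ### A hyperbolic germ along a planar or spherical curve -/

section

/-- The surface `c + v q + (m v² / 2) c' × q`: along `v = 0` it has the unit normal `c' × q` and
principal curvatures `det[c', q, c'']` and `m`. -/
def parabolicStrip (c q : ℝ → E3) (m : ℝ → ℝ) (p : ℝ × ℝ) : E3 :=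
  c p.1 + p.2 • q p.1 + (m p.1 / 2 * p.2 ^ 2) • cross (deriv c p.1) (q p.1)

variable {L l : ℝ} {c q : ℝ → E3} {m : ℝ → ℝ}

lemma IsParallelNormal.contDiff_strip (hq : IsParallelNormal L c l q)
    (hc : IsClosedFrenetCurve L c) (hm : ContDiff ℝ (⊤ : ℕ∞) m) :
    ContDiff ℝ (⊤ : ℕ∞) (parabolicStrip c q m) := by
  have h1 : ContDiff ℝ (⊤ : ℕ∞) fun s => cross (deriv c s) (q s) :=
    hc.contDiff_deriv.cross hq.smooth
  exact ((hc.smooth.comp contDiff_fst).add (contDiff_snd.smul (hq.smooth.comp contDiff_fst))).add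
    ((((hm.comp contDiff_fst).div_const 2).mul (contDiff_snd.pow 2)).smul (h1.comp contDiff_fst))

lemma IsParallelNormal.dv_strip (hq : IsParallelNormal L c l q)
    (hc : IsClosedFrenetCurve L c) (hm : ContDiff ℝ (⊤ : ℕ∞) m) (s v : ℝ) :
    dv (parabolicStrip c q m) (s, v) = q s + (m s * v) • cross (deriv c s) (q s) := by
  have h1 := hasDerivAt_dv (s := s) (v := v) ((hq.contDiff_strip hc hm).differentiable (by simp) _)
  have h2 : HasDerivAt (fun v => parabolicStrip c q m (s, v))
      (q s + (m s * v) • cross (deriv c s) (q s)) v := by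
    have h3 := (((hasDerivAt_id v).smul_const (q s)).const_add (c s)).add
      (((hasDerivAt_pow 2 v).const_mul (m s / 2)).smul_const (cross (deriv c s) (q s)))
    refine h3.congr_deriv ?_
    rw [one_smul]
    congr 2
    push_cast
    ring
  exact h1.unique h2

/-- The coefficients of the equation of principal lines along the core of the strip. -/
lemma IsParallelNormal.strip_core (hq : IsParallelNormal L c l q)
    (hc : IsClosedFrenetCurve L c) (hm : ContDiff ℝ (⊤ : ℕ∞) m) (s : ℝ) :
    gram (parabolicStrip c q m) (s, 0) = 1 ∧ detN (parabolicStrip c q m) (s, 0) = 0 ∧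
      dete (parabolicStrip c q m) (s, 0) = parallelCurvature c q s ∧
      detM (parabolicStrip c q m) (s, 0) = m s - parallelCurvature c q s := by
  set X := parabolicStrip c q m with hXdef
  have hX : ContDiff ℝ (⊤ : ℕ∞) X := hq.contDiff_strip hc hm
  have hX' : ∀ p, ContDiffAt ℝ 3 X p := fun p => hX.contDiffAt.of_le (WithTop.coe_le_coe.2 (le_top (a := (3 : ℕ∞))))
  have le2 : (2 : WithTop ℕ∞) + 1 ≤ 3 := by norm_num
  have e1 : ∀ s, du X (s, 0) = deriv c s := du_core
    (fun s => (hX' _).differentiableAt (by norm_num)) fun s => by simp [hXdef, parabolicStrip]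
  have e2 : ∀ s, dv X (s, 0) = q s := fun s => by rw [hq.dv_strip hc hm]; simp
  have e3 : du (du X) (s, 0) = deriv (deriv c) s := du_core
    (fun s => ((hX' _).du le2).differentiableAt (by norm_num)) e1 s
  have e4 : dv (du X) (s, 0) = l • deriv c s := by
    rw [← du_dv_comm ((hX' _).of_le (by norm_num)),
      du_core (fun s => ((hX' _).dv le2).differentiableAt (by norm_num)) e2]
    exact (hq.deriv_eq s).deriv
  have e5 : dv (dv X) (s, 0) = m s • cross (deriv c s) (q s) := by
    have h1 := hasDerivAt_dv (s := s) (v := 0) (((hX' (s, 0)).dv le2).differentiableAt (by norm_num))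
    have h2 : (fun v => dv X (s, v)) = fun v => q s + (m s * v) • cross (deriv c s) (q s) :=
      funext fun v => hq.dv_strip hc hm s v
    rw [h2] at h1
    have h3 := (((hasDerivAt_id (0 : ℝ)).const_mul (m s)).smul_const
      (cross (deriv c s) (q s))).const_add (q s)
    rw [h1.unique h3, mul_one]
  have hE : coeffE X (s, 0) = 1 := by rw [coeffE, e1, hc.inner_deriv]
  have hF : coeffF X (s, 0) = 0 := by rw [coeffF, e1, e2, hq.normal]
  have hG : coeffG X (s, 0) = 1 := by rw [coeffG, e2, hq.unit]
  have he : dete X (s, 0) = parallelCurvature c q s := by rw [dete, e1, e2, e3]; rfl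
  have hf : detf X (s, 0) = 0 := by
    rw [detf, e1, e2, e4, det3_eq]
    simp only [PiLp.smul_apply, smul_eq_mul]
    ring
  have hg : detg X (s, 0) = m s := by
    have h1 := det3_cross_self (deriv c s) (q s)
    rw [hc.inner_deriv, hq.unit, hq.normal] at h1
    have h2 : det3 (deriv c s) (q s) (m s • cross (deriv c s) (q s)) =
        m s * det3 (deriv c s) (q s) (cross (deriv c s) (q s)) := by
      rw [det3_eq, det3_eq]
      simp only [PiLp.smul_apply, smul_eq_mul]
      ring
    rw [detg, e1, e2, e5, h2, h1]
    ring
  refine ⟨by rw [gram, hE, hF, hG]; ring, by rw [detN, hE, hF, hf]; ring, he, ?_⟩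
  rw [detM, hE, hG, hg, he, one_mul, one_mul]

/-- If the curvature with respect to a parallel normal is not constant, then a suitable choice of
the other principal curvature makes the curve a hyperbolic principal cycle. -/
theorem IsParallelNormal.exists_hyperbolic (hq : IsParallelNormal L c l q)
    (hc : IsClosedFrenetCurve L c) {r : ℕ∞} (hr : 4 ≤ r)
    (hκ : ∃ s, deriv (parallelCurvature c q) s ≠ 0) :
    ∃ (ε : ℝ) (X : ℝ × ℝ → E3), IsOrientedSurfaceGerm r L c ε X ∧
      IsHyperbolicPrincipalCycle X L ε := by
  have hL := hc.length_pos
  set κ := parallelCurvature c q with hκdef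
  have hκs : ContDiff ℝ (⊤ : ℕ∞) κ := hq.contDiff_curvature hc
  have hκs' : ContDiff ℝ (⊤ : ℕ∞) (deriv κ) := (contDiff_infty_iff_deriv.1 hκs).2
  have hκp : Function.Periodic κ L := hq.periodic_curvature hc
  have hκp' : Function.Periodic (deriv κ) L := deriv_periodic hκp
  -- The gap `m - κ = exp (-κ')` between the principal curvatures makes the logarithm
  -- `-∫ κ' / (m - κ)` of the multiplier equal to `-∫ κ' exp κ' < 0`.
  set h : ℝ → ℝ := fun s => Real.exp (-deriv κ s) with hh
  set m : ℝ → ℝ := fun s => κ s + h s with hmdef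
  have hm : ContDiff ℝ (⊤ : ℕ∞) m := hκs.add hκs'.neg.exp
  set X := parabolicStrip c q m with hXdef
  have hX : ContDiff ℝ (⊤ : ℕ∞) X := hq.contDiff_strip hc hm
  have hcoreX := hq.strip_core hc hm
  have hg0 : ∀ s, 0 < gram X (s, 0) := fun s => by rw [(hcoreX s).1]; exact one_pos
  have hN0 : ∀ s, detN X (s, 0) = 0 := fun s => (hcoreX s).2.1
  have hM0 : ∀ s, detM X (s, 0) = h s := fun s => by
    rw [(hcoreX s).2.2.2]; exact add_sub_cancel_left _ _
  have hMpos : ∀ s, 0 < detM X (s, 0) := fun s => by rw [hM0]; exact Real.exp_pos _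
  have hX3 : ∀ p, ContDiffAt ℝ 3 X p := fun p => hX.contDiffAt.of_le (WithTop.coe_le_coe.2 (le_top (a := (3 : ℕ∞))))
  have hX0 : ∀ s, X (s, 0) = c s := fun s => by simp [hXdef, parabolicStrip]
  obtain ⟨ε, hgerm⟩ := hc.exists_germ r hX (fun s v => by
    simp only [hXdef, parabolicStrip, hmdef, hh, hc.periodic s, hq.periodic s, hκp s, hκp' s,
      deriv_periodic hc.periodic s]) hX0 hg0
  have hmin : IsLeaf X .minimal univ fun s => (s, (0 : ℝ)) :=
    isLeaf_minimal (v := fun _ => 0) (σ := fun _ => 0) uniqueDiffOn_univ fun t _ =>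
      ⟨hasDerivWithinAt_const _ _ _, hg0 t, hMpos t, by simp [hN0], by simpa using (hMpos t).le⟩
  have hcont : Continuous fun t => deriv κ t * Real.exp (deriv κ t) :=
    hκs'.continuous.mul (Real.continuous_exp.comp hκs'.continuous)
  have dκ : ∀ s, HasDerivAt (deriv κ) (deriv (deriv κ) s) s := fun s =>
    (hκs'.differentiable (by simp) s).hasDerivAt
  have ha : ∀ s, -fderiv ℝ (detN X) (s, 0) (0, 1) / detM X (s, 0) =
      deriv (deriv κ) s - deriv κ s * Real.exp (deriv κ s) := by
    intro s
    obtain ⟨Q', M', e', hQ, hM, he, hN, -⟩ := transversal_derivative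
      (fun s => hX3 (s, 0)) (coeffE_core (fun s => (hX3 _).differentiableAt (by norm_num)) hX0
        hc.unit_speed) hg0 hN0 s
    rw [funext fun s => (hcoreX s).1] at hQ
    rw [funext hM0] at hM
    rw [funext fun s => (hcoreX s).2.2.1] at he
    have hQ' : Q' = 0 := hQ.unique (hasDerivAt_const s (1 : ℝ))
    have he' : e' = deriv κ s := he.deriv.symm
    have hM' : M' = h s * -deriv (deriv κ) s := hM.unique (dκ s).neg.exp
    rw [hQ', he', hM', (hcoreX s).1] at hN
    have hN' : fderiv ℝ (detN X) (s, 0) (0, 1) = h s * -deriv (deriv κ) s + deriv κ s := by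
      linear_combination hN
    have h1 : h s * Real.exp (deriv κ s) = 1 := by
      rw [hh]
      simp only
      rw [← Real.exp_add, neg_add_cancel, Real.exp_zero]
    have h2 : h s ≠ 0 := (Real.exp_pos _).ne'
    rw [hN', hM0, div_eq_iff h2]
    linear_combination deriv κ s * h1
  set A : ℝ → ℝ := fun s =>
    deriv κ s - ∫ t in (0 : ℝ)..s, deriv κ t * Real.exp (deriv κ t) with hAdef
  have hA : ∀ s, HasDerivAt A (-fderiv ℝ (detN X) (s, 0) (0, 1) / detM X (s, 0)) s := fun s => by
    rw [ha]
    exact (dκ s).sub (hcont.integral_hasStrictDerivAt 0 s).hasDerivAt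
  have hac : Continuous fun s => -fderiv ℝ (detN X) (s, 0) (0, 1) / detM X (s, 0) := by
    rw [funext ha]
    exact ((contDiff_infty_iff_deriv.1 hκs').2.continuous).sub hcont
  have hleaf := exists_leaf (l := detL X) (m := detM X) (n := detN X) hL.le
    (fun s _ => contDiffAt_detL (hX3 _) (by norm_num))
    (fun s _ => contDiffAt_detM (hX3 _) (by norm_num))
    (fun s _ => contDiffAt_detN (hX3 _) (by norm_num)) (fun s _ => hMpos s) hN0
    (a := fun s => -fderiv ℝ (detN X) (s, 0) (0, 1) / detM X (s, 0))
    (fun s _ => hac.continuousAt)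
    (fun s _ => div_mul_cancel₀ _ (hMpos s).ne') (fun s _ => hA s) (half_pos hgerm.width_pos)
  -- The return map is read off from a choice of leaves.
  have hret : ∀ᶠ v₀ in 𝓝 (0 : ℝ), ∃ v : ℝ → ℝ, (∀ s ∈ Icc 0 L, v s ∈ Ioo (-ε) ε) ∧
      IsLeaf X .minimal (Icc 0 L) (fun s => (s, v s)) ∧ v 0 = v₀ := by
    filter_upwards [hleaf] with v₀ ⟨v, σ, hv, hv0⟩
    have hmem : ∀ s ∈ Icc 0 L, v s ∈ Ioo (-ε) ε := fun s hs =>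
      abs_lt.1 ((hv s hs).2.1.trans_lt (half_lt_self hgerm.width_pos))
    exact ⟨v, hmem, isLeaf_minimal (uniqueDiffOn_Icc hL) fun t ht =>
      ⟨(hv t ht).1, hgerm.gram_pos t (hmem t ht), (hv t ht).2.2⟩, hv0⟩
  obtain ⟨w, hw⟩ : ∃ w : ℝ → ℝ → ℝ, ∀ᶠ v₀ in 𝓝 (0 : ℝ), (∀ s ∈ Icc 0 L, w v₀ s ∈ Ioo (-ε) ε) ∧
      IsLeaf X .minimal (Icc 0 L) (fun s => (s, w v₀ s)) ∧ w v₀ 0 = v₀ := by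
    choose! w hw using fun (v₀ : ℝ) (h : ∃ v : ℝ → ℝ, (∀ s ∈ Icc 0 L, v s ∈ Ioo (-ε) ε) ∧
      IsLeaf X .minimal (Icc 0 L) (fun s => (s, v s)) ∧ v 0 = v₀) => h
    exact ⟨w, hret.mono hw⟩
  have hπ : IsReturnMap X L ε .minimal fun v₀ => w v₀ L := by
    filter_upwards [hw] with v₀ h
    exact ⟨w v₀, h.1, h.2.1, h.2.2, rfl⟩
  refine ⟨ε, X, hgerm, .minimal, hmin, fun v₀ => w v₀ L, _, hπ,
    hgerm.hasDerivAt_return hr hc hmin hA hπ, ?_⟩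
  have hκL : deriv κ L = deriv κ 0 := by simpa using hκp' 0
  have hint : 0 < ∫ t in (0 : ℝ)..L, (deriv κ t * Real.exp (deriv κ t) - deriv κ t) := by
    have hx : ∀ x : ℝ, 0 ≤ x * Real.exp x - x := fun x => by
      rcases le_total 0 x with h | h
      · nlinarith [Real.one_le_exp h]
      · nlinarith [Real.exp_le_one_iff.2 h]
    obtain ⟨s, hs⟩ := hκ
    obtain ⟨s', hs', hss'⟩ := hκp'.exists_mem_Ico₀ hL s
    refine intervalIntegral.integral_pos hL (hcont.sub hκs'.continuous).continuousOn
      (fun t _ => hx _) ⟨s', Ico_subset_Icc_self hs', ?_⟩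
    have hne : deriv κ s' ≠ 0 := hss' ▸ hs
    refine lt_of_le_of_ne (hx _) fun h0 => hne ?_
    have h1 : deriv κ s' * (Real.exp (deriv κ s') - 1) = 0 := by linarith
    rcases mul_eq_zero.1 h1 with h2 | h2
    · exact h2
    · exact Real.exp_eq_one_iff _ |>.1 (by linarith)
  rw [intervalIntegral.integral_sub (hcont.intervalIntegrable _ _)
    (hκs'.continuous.intervalIntegrable _ _), intervalIntegral.integral_deriv_eq_sub
    (fun s _ => hκs.differentiable (by simp) s) (hκs'.continuous.intervalIntegrable _ _),
    show κ L = κ 0 by simpa using hκp 0, sub_self, sub_zero] at hint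
  have hlt : A L - A 0 < 0 := by
    simp only [hAdef, hκL, intervalIntegral.integral_same]
    linarith
  exact (Real.exp_lt_one_iff.2 hlt).ne

end

end PrincipalCycle

end

theorem corollary3p4 (r : ℕ∞) (hr : 4 ≤ r) (L : ℝ) (c : ℝ → EuclideanSpace ℝ (Fin 3))
    (hc : PrincipalCycle.IsClosedFrenetCurve L c)
    (hplane : Coplanar ℝ (Set.range c) ∨ EuclideanGeometry.Cospherical (Set.range c)) :
    (∃ (ε : ℝ) (X : ℝ × ℝ → EuclideanSpace ℝ (Fin 3)),
        PrincipalCycle.IsOrientedSurfaceGerm r L c ε X ∧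
        PrincipalCycle.IsHyperbolicPrincipalCycle X L ε) ↔
      ¬ PrincipalCycle.IsCircle (Set.range c) := by
  constructor
  · rintro ⟨ε, X, hX, hhyp⟩ hcirc
    exact hc.not_hyperbolic_of_isCircle hr hcirc hX hhyp
  · intro hcirc
    obtain ⟨l, q, hq⟩ : ∃ l q, PrincipalCycle.IsParallelNormal L c l q :=
      hplane.elim hc.exists_parallel_of_coplanar hc.exists_parallel_of_cospherical
    refine hq.exists_hyperbolic hc hr ?_
    by_contra! hκ
    have hconst : ∀ s, PrincipalCycle.parallelCurvature c q s =
        PrincipalCycle.parallelCurvature c q 0 := fun s =>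
      is_const_of_deriv_eq_zero ((hq.contDiff_curvature hc).differentiable (by simp)) hκ s 0
    obtain ⟨ω, hω, h⟩ := hq.third_deriv hc hconst
    exact hcirc (hc.isCircle_of_third_deriv hω h)
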